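/- Let $\Phi:\mathbb{C}[x]\to[0,\infty)$ be a multiplicative distance function, that is: $\Phi$ is continuous as a function of the coefficient vector on every finite-dimensional subspace of $\mathbb{C}[x]$; $\Phi(f)=0$ if and only if $f=0$; $\Phi(wf)=|w|\,\Phi(f)$ and $\Phi(fg)=\Phi(f)\Phi(g)$ for all $w\in\mathbb{C}$ and $f,g\in\mathbb{C}[x]$. Let $\phi(\gamma)=\Phi(x-\gamma)$ for $\gamma\in\mathbb{C}$. Let $N=2J$ be even and let $s\in\mathbb{C}$ with $\operatorname{Re}(s)>N$. Put \[ F_N(\Phi;s)=\int_{\mathbb{R}^N}\Phi\Big(x^N+\sum_{n=1}^N b_n x^{N-n}\Big)^{-s}\,d\lambda_N(\mathbf b), \] where $\lambda_N$ is Lebesgue measure on $\mathbb{R}^N$. For polynomials $P,Q\in\mathbb{C}[x]$ of degree at most $N-1$ put \[ \langle P,Q\rangle=\int_{\mathbb{R}^2}\phi(x)^{-s}\phi(y)^{-s}P(x)Q(y)\,\operatorname{sgn}(y-x)\,dx\,dy -2i\int_{\mathbb{C}}\phi(\beta)^{-s}\phi(\overline\beta)^{-s}P(\overline\beta)Q(\beta)\,\operatorname{sgn}(\operatorname{Im}\beta)\,d\lambda_2(\beta),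 \] where $\lambda_2$ is Lebesgue measure on $\mathbb{C}$. Let $Q_1,\dots,Q_N\in\mathbb{C}[x]$ be monic with $\deg Q_n=n-1$, and suppose that they are skew-orthogonal with normalizations $\mathfrak{M}_1,\dots,\mathfrak{M}_J\in\mathbb{C}$, that is, for all $j,k\in\{1,\dots,J\}$, \[ \langle Q_{2k-1},Q_{2j}\rangle=-\langle Q_{2j},Q_{2k-1}\rangle=\delta_{kj}\,\mathfrak{M}_j,\qquad \langle Q_{2j},Q_{2k}\rangle=\langle Q_{2j-1},Q_{2k-1}\rangle=0 . \] Then the integral defining $F_N(\Phi;s)$ converges absolutely, and \[ F_N(\Phi;s)=\prod_{j=1}^J\mathfrak{M}_j . \] -/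

import Mathlib

open Polynomial MeasureTheory

noncomputable section

/-- A multiplicative distance function on `ℂ[x]`: a function to `[0, ∞)` which is continuous in the
coefficient vector on polynomials of bounded degree (equivalently, on every finite-dimensional
subspace), positive definite, absolutely homogeneous and multiplicative. -/
structure IsMultiplicativeDistanceFunction (Φ : ℂ[X] → ℝ) : Prop where
  nonneg : ∀ f, 0 ≤ Φ f
  continuous_coeff : ∀ n : ℕ,
    Continuous fun c : Fin n → ℂ => Φ (∑ i : Fin n, C (c i) * X ^ (i : ℕ))
  eq_zero_iff : ∀ f, Φ f = 0 ↔ f = 0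
  map_C_mul : ∀ (w : ℂ) (f : ℂ[X]), Φ (C w * f) = ‖w‖ * Φ f
  map_mul : ∀ f g : ℂ[X], Φ (f * g) = Φ f * Φ g

/-- The root function `φ(γ) = Φ(x - γ)`. -/
def rootFunction (Φ : ℂ[X] → ℝ) (γ : ℂ) : ℝ := Φ (X - C γ)

/-- The monic polynomial `x^N + b₁ x^(N-1) + ⋯ + b_N` with real coefficient vector `b`
(the coordinate `b_n` is `b ⟨n - 1, _⟩`). -/
def monicPoly (N : ℕ) (b : Fin N → ℝ) : ℂ[X] :=
  X ^ N + ∑ i : Fin N, C ((b i : ℝ) : ℂ) * X ^ (N - ((i : ℕ) + 1))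

/-- The integrand `Φ̃(b)^(-s)` of the real moment function. -/
def momentIntegrand (Φ : ℂ[X] → ℝ) (N : ℕ) (s : ℂ) (b : Fin N → ℝ) : ℂ :=
  ((Φ (monicPoly N b) : ℝ) : ℂ) ^ (-s)

/-- The degree `N` real moment function `F_N(Φ; s)`. -/
def realMoment (Φ : ℂ[X] → ℝ) (N : ℕ) (s : ℂ) : ℂ :=
  ∫ b : Fin N → ℝ, momentIntegrand Φ N s b

/-- The real skew-symmetric bilinear form `⟨P, Q⟩_ℝ`. -/
def realSkewForm (Φ : ℂ[X] → ℝ) (s : ℂ) (P Q : ℂ[X]) : ℂ :=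
  ∫ p : ℝ × ℝ, ((rootFunction Φ (p.1 : ℂ) : ℝ) : ℂ) ^ (-s) *
    ((rootFunction Φ (p.2 : ℂ) : ℝ) : ℂ) ^ (-s) *
    P.eval (p.1 : ℂ) * Q.eval (p.2 : ℂ) * ((Real.sign (p.2 - p.1) : ℝ) : ℂ)

/-- The complex skew-symmetric bilinear form `⟨P, Q⟩_ℂ`. -/
def complexSkewForm (Φ : ℂ[X] → ℝ) (s : ℂ) (P Q : ℂ[X]) : ℂ :=
  -2 * Complex.I * ∫ β : ℂ, ((rootFunction Φ β : ℝ) : ℂ) ^ (-s) *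
    ((rootFunction Φ (starRingEnd ℂ β) : ℝ) : ℂ) ^ (-s) *
    P.eval (starRingEnd ℂ β) * Q.eval β * ((Real.sign β.im : ℝ) : ℂ)

/-- The skew-symmetric bilinear form `⟨P, Q⟩ = ⟨P, Q⟩_ℝ + ⟨P, Q⟩_ℂ`. -/
def skewForm (Φ : ℂ[X] → ℝ) (s : ℂ) (P Q : ℂ[X]) : ℂ :=
  realSkewForm Φ s P Q + complexSkewForm Φ s P Q

/-- A complete family of `N` monic polynomials. With indices counted from `0`, the `n`-th member
has degree `n`. -/
def IsCompleteMonicFamily {N : ℕ} (Q : Fin N → ℂ[X]) : Prop :=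
  ∀ n : Fin N, (Q n).Monic ∧ (Q n).natDegree = (n : ℕ)

/-- Position of the first member `Q_{2j-1}` (one-based) of the `j`-th pair. -/
def pairFst {J : ℕ} (j : Fin J) : Fin (2 * J) := ⟨2 * (j : ℕ), by omega⟩

/-- Position of the second member `Q_{2j}` (one-based) of the `j`-th pair. -/
def pairSnd {J : ℕ} (j : Fin J) : Fin (2 * J) := ⟨2 * (j : ℕ) + 1, by omega⟩

/-- `Q` is skew-orthogonal with respect to `⟨·,·⟩`, with normalizations `M`. -/
structure IsSkewOrthogonal (Φ : ℂ[X] → ℝ) (s : ℂ) {J : ℕ}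
    (Q : Fin (2 * J) → ℂ[X]) (M : Fin J → ℂ) : Prop where
  fst_snd : ∀ k j : Fin J,
    skewForm Φ s (Q (pairFst k)) (Q (pairSnd j)) = if k = j then M j else 0
  snd_fst : ∀ k j : Fin J,
    -skewForm Φ s (Q (pairSnd j)) (Q (pairFst k)) = if k = j then M j else 0
  snd_snd : ∀ j k : Fin J, skewForm Φ s (Q (pairSnd j)) (Q (pairSnd k)) = 0
  fst_fst : ∀ j k : Fin J, skewForm Φ s (Q (pairFst j)) (Q (pairFst k)) = 0

end

/-! Write a monic real polynomial of degree `2J` as a product of `J` monic real quadratics. The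
Jacobian of multiplication is a product of resultants of pairs of factors (`det_mulMonicDeriv`,
`resultantProd`). Keeping its sign, instead of its absolute value, makes the number of real roots
irrelevant: the signed fibre counts are constant almost everywhere.

The count goes one quadratic at a time. For a separable `p` of even degree `2m`, the factorizations
`p = q * g` with `q` a monic quadratic correspond to pairs `a < b` of real roots and to roots `β` in
the upper half plane. The sign of the resultant is `-e(a)e(b)` in the first case, `e` being the sign
of `p'` up to a common factor, and `+1` in the second. The signs `e` alternate along an even number
of real roots, so they sum to zero, and expanding the square of that sum shows that the real pairs
contribute half the number of real roots. The total is `m` (`exists_fiber_mulMonic`). A signed area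
formula (`integral_det_mul_comp_of_signed_fiber_card`) and induction on `J` then give `J! * F_N` as
an integral over `J`-tuples of quadratics (`integral_quadPullback`).

In that integral the product of resultants is the Vandermonde determinant of all roots divided by
the difference of the two roots within each quadratic. Expressed through the `Q_n` and
antisymmetrized in each pair, it becomes a signed sum of products of functions of one quadratic each
(`two_pow_mul_resultantProd`), so Fubini applies. Each single integral is `⟨P, Q⟩`: positive
discriminant gives the real part of the form, negative discriminant the complex part
(`integral_polyWeight_mul_pairKernel`). Skew-orthogonality evaluates the signed sum as `2^J * J! * ∏
M_j` (`sum_perm_prod_skew_block`), and the constants cancel. -/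

/-! ### Signed area formula. -/

section AreaFormula

open Set Function
open scoped NNReal ENNReal

variable {E : Type*} [NormedAddCommGroup E] [NormedSpace ℝ E] [FiniteDimensional ℝ E]

/-- A quantitative inverse function theorem: a perturbation of an invertible `A` smaller than
`‖A⁻¹‖⁻¹` stays injective. A singular `A` gets the dummy value `1`, so that `δ` is a total function
of `A`. -/
theorem ContinuousLinearMap.exists_pos_injOn_of_det_ne_zero (A : E →L[ℝ] E) :
    ∃ δ : ℝ≥0, δ ≠ 0 ∧ (A.det ≠ 0 → ∀ (t : Set E) (g : E → E),
      ApproximatesLinearOn g A t δ → InjOn g t) := by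
  by_cases hA : A.det = 0
  · exact ⟨1, one_ne_zero, fun h => absurd hA h⟩
  let A' := A.toContinuousLinearEquivOfDetNeZero hA
  have hA' : (A' : E →L[ℝ] E) = A := A.coe_toContinuousLinearEquivOfDetNeZero hA
  rcases A'.subsingleton_or_nnnorm_symm_pos with hE | hN
  · exact ⟨1, one_ne_zero, fun _ t g _ x _ y _ _ => Subsingleton.elim x y⟩
  · refine ⟨‖(A'.symm : E →L[ℝ] E)‖₊⁻¹ / 2, by positivity, fun _ t g hg => ?_⟩
    rw [← hA'] at hg
    refine hg.injOn (Or.inr ?_)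
    exact NNReal.half_lt_self (inv_ne_zero hN.ne')

variable [MeasurableSpace E] [BorelSpace E]

theorem exists_signed_injOn_partition {F : E → E} {F' : E → E →L[ℝ] E}
    (hF : ∀ x, HasFDerivAt F (F' x) x) (hdet : Measurable fun x => (F' x).det) :
    ∃ (A : ℕ × Bool → Set E) (ε : ℕ × Bool → ℝ), Pairwise (Disjoint on A) ∧
      (∀ i, MeasurableSet (A i)) ∧ (⋃ i, A i) = {x | (F' x).det ≠ 0} ∧
      (∀ i, InjOn F (A i)) ∧ (∀ i, ∀ x ∈ A i, Real.sign (F' x).det = ε i) := by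
  choose δ hδ using fun A : E →L[ℝ] E => A.exists_pos_injOn_of_det_ne_zero
  obtain ⟨t, L, hdisj, hmeas, hcover, happrox, hL⟩ :=
    exists_partition_approximatesLinearOn_of_hasFDerivWithinAt F {x | (F' x).det ≠ 0} F'
      (fun x _ => (hF x).hasFDerivWithinAt) δ (fun A => (hδ A).1)
  have hpos : MeasurableSet {x | 0 < (F' x).det} := hdet measurableSet_Ioi
  have hneg : MeasurableSet {x | (F' x).det < 0} := hdet measurableSet_Iio
  refine ⟨fun i => t i.1 ∩ bif i.2 then {x | 0 < (F' x).det} else {x | (F' x).det < 0},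
    fun i => bif i.2 then 1 else -1, ?_, ?_, ?_, ?_, ?_⟩
  · rintro ⟨n, a⟩ ⟨m, b⟩ hne
    simp only [onFun]
    by_cases hnm : n = m
    · subst hnm
      rw [Set.disjoint_left]
      rintro x ⟨-, h1⟩ ⟨-, h2⟩
      cases a <;> cases b <;> simp at hne h1 h2 <;> linarith
    · exact (hdisj hnm).mono inter_subset_left inter_subset_left
  · rintro ⟨n, a⟩
    cases a
    · exact (hmeas n).inter hneg
    · exact (hmeas n).inter hpos
  · ext x
    simp only [mem_iUnion, mem_inter_iff, mem_ofPred_eq, Prod.exists]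
    constructor
    · rintro ⟨n, a, -, h⟩
      cases a
      · exact ne_of_lt h
      · exact ne_of_gt h
    · intro h
      obtain ⟨n, hn⟩ := mem_iUnion.1 (hcover h)
      rcases lt_or_gt_of_ne h with h | h
      · exact ⟨n, false, hn, h⟩
      · exact ⟨n, true, hn, h⟩
  · rintro ⟨n, a⟩ x hx
    have hne : ∀ y ∈ t n ∩ (bif a then {x | 0 < (F' x).det} else {x | (F' x).det < 0}),
        y ∈ {x | (F' x).det ≠ 0} ∩ t n := by
      rintro y ⟨h1, h2⟩
      refine ⟨?_, h1⟩
      cases a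
      · exact ne_of_lt h2
      · exact ne_of_gt h2
    -- Each linear model `L n` is the derivative at an actual regular point, hence invertible, so
    -- the choice of `δ` forces injectivity.
    obtain ⟨y, hy, hyL⟩ := hL ⟨x, (hne x hx).1⟩ n
    have hinj := (hδ (L n)).2 (by rw [hyL]; exact hy) _ F (happrox n)
    exact hinj.mono hne hx
  · rintro ⟨n, a⟩ x ⟨-, hx⟩
    cases a
    · exact Real.sign_of_neg hx
    · exact Real.sign_of_pos hx

/-- Apply the change of variables on each injective piece and sum. Critical points need no
exclusion: they have zero Jacobian on the left and zero sign in the fibre sum. The signed count `c`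
gives the value; the unsigned bound `K` gives absolute convergence, which a signed count alone
cannot. -/
theorem integral_det_mul_comp_of_signed_fiber_card (μ : Measure E) [μ.IsAddHaarMeasure]
    {F : E → E} {F' : E → E →L[ℝ] E}
    (hF : ∀ x, HasFDerivAt F (F' x) x) (hdet : Measurable fun x => (F' x).det)
    {c : ℝ} {K : ℕ}
    (hfib : ∀ᵐ b ∂μ, ∃ S : Finset E, (∀ x, F x = b → x ∈ S) ∧ (∀ x ∈ S, F x = b) ∧
      ∑ x ∈ S, Real.sign (F' x).det = c ∧ S.card ≤ K)
    {f : E → ℂ} (hf : Integrable f μ) :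
    Integrable (fun x => (((F' x).det : ℝ) : ℂ) * f (F x)) μ ∧
      ∫ x, (((F' x).det : ℝ) : ℂ) * f (F x) ∂μ = c * ∫ b, f b ∂μ ∧
      ∫ x, ‖(((F' x).det : ℝ) : ℂ) * f (F x)‖ ∂μ ≤ K * ∫ b, ‖f b‖ ∂μ := by
  classical
  obtain ⟨A, ε, hdisj, hmeas, hunion, hinj, hsign⟩ := exists_signed_injOn_partition hF hdet
  have hFd : ∀ i, ∀ x ∈ A i, HasFDerivWithinAt F (F' x) (A i) x :=
    fun i x _ => (hF x).hasFDerivWithinAt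
  have himg : ∀ i, MeasurableSet (F '' A i) := fun i =>
    measurable_image_of_fderivWithin (hmeas i) (hFd i) (hinj i)
  set g : E → ℂ := fun x => (((F' x).det : ℝ) : ℂ) * f (F x) with hg
  have hdetε : ∀ i, ∀ x ∈ A i, g x = (ε i : ℂ) * (|(F' x).det| • f (F x)) := by
    intro i x hx
    have h := hsign i x hx
    simp only [hg]
    rw [← h, Complex.real_smul, ← mul_assoc, ← Complex.ofReal_mul]
    congr 2
    rcases lt_trichotomy (F' x).det 0 with h | h | h
    · rw [Real.sign_of_neg h, abs_of_neg h]; ring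
    · simp [h]
    · rw [Real.sign_of_pos h, abs_of_pos h]; ring
  have hint : ∀ i, IntegrableOn g (A i) μ := by
    intro i
    have h1 := (integrableOn_image_iff_integrableOn_abs_det_fderiv_smul μ (hmeas i) (hFd i)
      (hinj i) f).1 hf.integrableOn
    exact IntegrableOn.congr_fun (h1.const_mul (ε i : ℂ)) (fun x hx => (hdetε i x hx).symm)
      (hmeas i)
  have hval : ∀ i, ∫ x in A i, g x ∂μ = ∫ b, (F '' A i).indicator (fun b => (ε i : ℂ) * f b) b ∂μ := by
    intro i
    rw [integral_indicator (himg i), integral_const_mul,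
      integral_image_eq_integral_abs_det_fderiv_smul μ (hmeas i) (hFd i) (hinj i) f,
      ← integral_const_mul]
    exact setIntegral_congr_fun (hmeas i) (hdetε i)
  have hnorm : ∀ i, ∫ x in A i, ‖g x‖ ∂μ = ∫ b, (F '' A i).indicator (fun b => ‖f b‖) b ∂μ := by
    intro i
    rw [integral_indicator (himg i),
      integral_image_eq_integral_abs_det_fderiv_smul μ (hmeas i) (hFd i) (hinj i) (fun b => ‖f b‖)]
    refine setIntegral_congr_fun (hmeas i) fun x hx => ?_
    simp [hg]
  -- By injectivity a piece meets a fibre in at most one point, so the indicator of its image is a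
  -- sum over the fibre.
  have hpt : ∀ {S : Finset E} {b : E}, (∀ x, F x = b → x ∈ S) → (∀ x ∈ S, F x = b) →
      ∀ {V : Type} [AddCommMonoid V] (i : ℕ × Bool) (w : E → V),
      (F '' A i).indicator w b = ∑ x ∈ S, if x ∈ A i then w b else 0 := by
    intro S b hS1 hS2 V _ i w
    by_cases hb : b ∈ F '' A i
    · obtain ⟨x, hx, rfl⟩ := hb
      rw [indicator_of_mem (mem_image_of_mem F hx), Finset.sum_eq_single_of_mem x (hS1 x rfl),
        if_pos hx]
      intro y hy hyx
      exact if_neg fun hyA => hyx (hinj i hyA hx (hS2 y hy))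
    · rw [indicator_of_notMem hb, Finset.sum_eq_zero]
      intro x hx
      exact if_neg fun hxA => hb ⟨x, hxA, hS2 x hx⟩
  -- The pieces are disjoint, so each fibre point is counted at most once.
  have hle : ∀ᵐ b ∂μ, ∀ T : Finset (ℕ × Bool),
      ∑ i ∈ T, (F '' A i).indicator (fun b => ‖f b‖) b ≤ K * ‖f b‖ := by
    filter_upwards [hfib] with b ⟨S, hS1, hS2, _, hS4⟩ T
    simp_rw [hpt hS1 hS2]
    rw [Finset.sum_comm]
    calc ∑ x ∈ S, ∑ i ∈ T, (if x ∈ A i then ‖f b‖ else 0) ≤ ∑ x ∈ S, ‖f b‖ := by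
          refine Finset.sum_le_sum fun x _ => ?_
          by_cases hx : ∃ i ∈ T, x ∈ A i
          · obtain ⟨i, hi, hxi⟩ := hx
            rw [Finset.sum_eq_single_of_mem i hi, if_pos hxi]
            intro j _ hji
            exact if_neg fun hxj => (Set.disjoint_left.1 (hdisj hji) hxj hxi)
          · rw [Finset.sum_eq_zero]
            · exact norm_nonneg _
            · intro i hi
              exact if_neg fun hxi => hx ⟨i, hi, hxi⟩
      _ = S.card * ‖f b‖ := by simp
      _ ≤ K * ‖f b‖ := by gcongr
  have hindint : ∀ i, Integrable (fun b => (F '' A i).indicator (fun b => ‖f b‖) b) μ :=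
    fun i => hf.norm.indicator (himg i)
  have hpartial : ∀ T : Finset (ℕ × Bool),
      ∑ i ∈ T, ∫ x in A i, ‖g x‖ ∂μ ≤ K * ∫ b, ‖f b‖ ∂μ := by
    intro T
    simp_rw [hnorm]
    rw [← integral_finsetSum T (fun i _ => hindint i), ← integral_const_mul]
    refine integral_mono_ae (integrable_finsetSum T fun i _ => hindint i)
      (hf.norm.const_mul _) ?_
    filter_upwards [hle] with b hb using hb T
  have hnn : ∀ i, 0 ≤ ∫ x in A i, ‖g x‖ ∂μ := fun i => integral_nonneg fun _ => norm_nonneg _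
  have hsum : Summable fun i => ∫ x in A i, ‖g x‖ ∂μ := summable_of_sum_le hnn hpartial
  have hgU : IntegrableOn g (⋃ i, A i) μ :=
    integrableOn_iUnion_of_summable_integral_norm hint hsum
  have hzero : ∀ x, x ∉ ⋃ i, A i → g x = 0 := by
    intro x hx
    rw [hunion] at hx
    have : (F' x).det = 0 := not_not.1 hx
    simp [hg, this]
  refine ⟨(integrableOn_iff_integrable_of_support_subset
    (fun x hx => by_contra fun h => hx (hzero x h))).1 hgU, ?_, ?_⟩
  · rw [← setIntegral_eq_integral_of_forall_compl_eq_zero hzero,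
      integral_iUnion hmeas hdisj hgU]
    simp_rw [hval]
    have hI : ∀ i, Integrable (fun b => (F '' A i).indicator (fun b => (ε i : ℂ) * f b) b) μ :=
      fun i => (hf.const_mul _).indicator (himg i)
    have hIsum : Summable fun i =>
        ∫ b, ‖(F '' A i).indicator (fun b => (ε i : ℂ) * f b) b‖ ∂μ := by
      refine hsum.of_nonneg_of_le (fun i => integral_nonneg fun _ => norm_nonneg _) fun i => ?_
      rw [hnorm]
      refine integral_mono (hI i).norm (hindint i) fun b => ?_
      simp only [norm_indicator_eq_indicator_norm]
      refine indicator_le_indicator' fun hb => ?_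
      obtain ⟨x, hx, rfl⟩ := hb
      rw [norm_mul, Complex.norm_real, Real.norm_eq_abs, ← hsign i x hx]
      refine mul_le_of_le_one_left (norm_nonneg _) ?_
      rcases Real.sign_apply_eq (F' x).det with h | h | h <;> simp [h]
    -- Sum over pieces and integral are exchanged; what remains is the pointwise identity that the
    -- signs over a fibre add up to `c`.
    rw [(hasSum_integral_of_summable_integral_norm hI hIsum).tsum_eq, ← integral_const_mul]
    refine integral_congr_ae ?_
    filter_upwards [hfib] with b ⟨S, hS1, hS2, hS3, _⟩
    have h1 : HasSum (fun i => ∑ x ∈ S, if x ∈ A i then (ε i : ℂ) * f b else 0)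
        (∑ x ∈ S, ((Real.sign (F' x).det : ℝ) : ℂ) * f b) := by
      refine hasSum_sum fun x _ => ?_
      by_cases hx : x ∈ ⋃ i, A i
      · obtain ⟨i, hi⟩ := mem_iUnion.1 hx
        have h2 := hasSum_ite_eq i (((Real.sign (F' x).det : ℝ) : ℂ) * f b)
        convert h2 using 2 with j
        by_cases hj : j = i
        · subst hj
          rw [if_pos hi, if_pos rfl, hsign j x hi]
        · rw [if_neg hj, if_neg fun h => Set.disjoint_left.1 (hdisj hj) h hi]
      · have h0 : (F' x).det = 0 := by
          rw [hunion] at hx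
          exact not_not.1 hx
        rw [h0, Real.sign_zero, Complex.ofReal_zero, zero_mul]
        have : (fun i => if x ∈ A i then (ε i : ℂ) * f b else 0) = fun _ => 0 := by
          funext i
          exact if_neg fun h => hx (mem_iUnion.2 ⟨i, h⟩)
        rw [this]
        exact hasSum_zero
    simp_rw [hpt hS1 hS2]
    rw [h1.tsum_eq, ← Finset.sum_mul, ← Complex.ofReal_sum, hS3]
  · rw [← setIntegral_eq_integral_of_forall_compl_eq_zero (s := ⋃ i, A i)
      (f := fun x => ‖g x‖)
      (fun x hx => by rw [hzero x hx, norm_zero]), integral_iUnion hmeas hdisj hgU.norm]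
    exact Real.tsum_le_of_sum_le hnn hpartial

end AreaFormula

/-! ### Multiplication of monic polynomials in coordinates. -/

section MonicCoordinates

/-- The polynomial of degree less than `n` with coefficient vector `c`, as a linear map. -/
noncomputable def polyOfCoeffs (n : ℕ) : (Fin n → ℝ) →ₗ[ℝ] ℝ[X] where
  toFun c := ∑ i : Fin n, C (c i) * X ^ (i : ℕ)
  map_add' c d := by simp [add_mul, Finset.sum_add_distrib]
  map_smul' r c := by simp [Finset.mul_sum, smul_eq_C_mul, mul_assoc]

/-- The monic real polynomial of degree `n` with lower coefficients `c`. -/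
noncomputable def toMonic {n : ℕ} (c : Fin n → ℝ) : ℝ[X] := X ^ n + polyOfCoeffs n c

/-- The first `n` coefficients of a polynomial. -/
noncomputable def lowerCoeffs (n : ℕ) (p : ℝ[X]) : Fin n → ℝ := fun i => p.coeff i

theorem degree_polyOfCoeffs_lt {n : ℕ} (c : Fin n → ℝ) : (polyOfCoeffs n c).degree < n :=
  degree_sum_fin_lt c

theorem toMonic_monic {n : ℕ} (c : Fin n → ℝ) : (toMonic c).Monic :=
  monic_X_pow_add (degree_polyOfCoeffs_lt c)

theorem natDegree_toMonic {n : ℕ} (c : Fin n → ℝ) : (toMonic c).natDegree = n := by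
  have h : (toMonic c).degree = n := by
    rw [toMonic, degree_add_eq_left_of_degree_lt] <;> rw [degree_X_pow]
    exact degree_polyOfCoeffs_lt c
  exact natDegree_eq_of_degree_eq_some h

theorem lowerCoeffs_toMonic {n : ℕ} (c : Fin n → ℝ) : lowerCoeffs n (toMonic c) = c := by
  funext i
  simp only [lowerCoeffs, toMonic, polyOfCoeffs, LinearMap.coe_mk, AddHom.coe_mk, coeff_add,
    coeff_X_pow, finsetSum_coeff, coeff_C_mul]
  rw [if_neg i.2.ne, Finset.sum_eq_single i]
  · simp
  · intro j _ hj
    simp [Fin.val_eq_val, hj.symm]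
  · simp

theorem toMonic_lowerCoeffs {n : ℕ} {p : ℝ[X]} (hp : p.Monic) (hn : p.natDegree = n) :
    toMonic (lowerCoeffs n p) = p := by
  subst hn
  conv_rhs => rw [hp.as_sum]
  simp [toMonic, polyOfCoeffs, lowerCoeffs, Finset.sum_range]

/-- The polynomial encoded by the first `m` coordinates. -/
noncomputable def leftFactor {m n : ℕ} (v : Fin (m + n) → ℝ) : ℝ[X] :=
  toMonic fun i : Fin m => v (Fin.castAdd n i)

/-- The polynomial encoded by the last `n` coordinates. -/
noncomputable def rightFactor {m n : ℕ} (v : Fin (m + n) → ℝ) : ℝ[X] :=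
  toMonic fun i : Fin n => v (Fin.natAdd m i)

/-- Multiplication of monic polynomials of degrees `m` and `n` in coordinates. -/
noncomputable def mulMonic (m n : ℕ) (v : Fin (m + n) → ℝ) : Fin (m + n) → ℝ :=
  lowerCoeffs (m + n) (leftFactor v * rightFactor v)

theorem toMonic_mulMonic {m n : ℕ} (v : Fin (m + n) → ℝ) :
    toMonic (mulMonic m n v) = leftFactor v * rightFactor v := by
  refine toMonic_lowerCoeffs ((toMonic_monic _).mul (toMonic_monic _)) ?_
  rw [leftFactor, rightFactor, (toMonic_monic _).natDegree_mul (toMonic_monic _),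
    natDegree_toMonic, natDegree_toMonic]

/-- The derivative of `mulMonic`. -/
noncomputable def mulMonicDeriv (m n : ℕ) (v : Fin (m + n) → ℝ) :
    (Fin (m + n) → ℝ) →L[ℝ] (Fin (m + n) → ℝ) :=
  LinearMap.toContinuousLinearMap
    (Matrix.toLin' (sylvester (leftFactor v) (rightFactor v) m n))

theorem det_mulMonicDeriv {m n : ℕ} (v : Fin (m + n) → ℝ) :
    (mulMonicDeriv m n v).det = resultant (leftFactor (n := n) v) (rightFactor (m := m) v) := by
  rw [mulMonicDeriv, ContinuousLinearMap.det, LinearMap.coe_toContinuousLinearMap,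
    LinearMap.det_toLin', resultant, leftFactor, rightFactor, natDegree_toMonic,
    natDegree_toMonic]

theorem coeff_mul_polyOfCoeffs {n : ℕ} (p : ℝ[X]) (c : Fin n → ℝ) (i : ℕ) :
    (p * polyOfCoeffs n c).coeff i =
      ∑ j : Fin n, (if (j : ℕ) ≤ i then p.coeff (i - j) else 0) * c j := by
  simp only [polyOfCoeffs, LinearMap.coe_mk, AddHom.coe_mk, Finset.mul_sum, finsetSum_coeff]
  refine Finset.sum_congr rfl fun j _ => ?_
  rw [← mul_assoc, coeff_mul_X_pow', coeff_mul_C]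
  split_ifs <;> simp

/-- By the product rule, moving the factors `(f, g)` in the direction `(h, k)` changes `f * g` to
first order by `g * h + f * k`, and the matrix of this map is the Sylvester matrix. -/
theorem hasFDerivAt_mulMonic {m n : ℕ} (v : Fin (m + n) → ℝ) :
    HasFDerivAt (mulMonic m n) (mulMonicDeriv m n v) v := by
  let ℓ₁ : ℕ → (Fin (m + n) → ℝ) →L[ℝ] ℝ := fun a => LinearMap.toContinuousLinearMap
    (lcoeff ℝ a ∘ₗ polyOfCoeffs m ∘ₗ LinearMap.funLeft ℝ ℝ (Fin.castAdd n))
  let ℓ₂ : ℕ → (Fin (m + n) → ℝ) →L[ℝ] ℝ := fun a => LinearMap.toContinuousLinearMap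
    (lcoeff ℝ a ∘ₗ polyOfCoeffs n ∘ₗ LinearMap.funLeft ℝ ℝ (Fin.natAdd m))
  have h₁ : ∀ a, HasFDerivAt (fun w : Fin (m + n) → ℝ => (leftFactor (n := n) w).coeff a)
      (ℓ₁ a) v := by
    intro a
    have : (fun w : Fin (m + n) → ℝ => (leftFactor (n := n) w).coeff a) =
        fun w => (X ^ m : ℝ[X]).coeff a + ℓ₁ a w := by
      funext w
      simp only [leftFactor, toMonic, coeff_add]
      rfl
    rw [this]
    exact (ℓ₁ a).hasFDerivAt.const_add _
  have h₂ : ∀ a, HasFDerivAt (fun w : Fin (m + n) → ℝ => (rightFactor (m := m) w).coeff a)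
      (ℓ₂ a) v := by
    intro a
    have : (fun w : Fin (m + n) → ℝ => (rightFactor (m := m) w).coeff a) =
        fun w => (X ^ n : ℝ[X]).coeff a + ℓ₂ a w := by
      funext w
      simp only [rightFactor, toMonic, coeff_add]
      rfl
    rw [this]
    exact (ℓ₂ a).hasFDerivAt.const_add _
  refine hasFDerivAt_pi'' fun i => ?_
  have h : HasFDerivAt (fun w : Fin (m + n) → ℝ =>
      ∑ ab ∈ Finset.HasAntidiagonal.antidiagonal (i : ℕ),
        (leftFactor (n := n) w).coeff ab.1 * (rightFactor (m := m) w).coeff ab.2)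
      (∑ ab ∈ Finset.HasAntidiagonal.antidiagonal (i : ℕ),
        ((leftFactor (n := n) v).coeff ab.1 • ℓ₂ ab.2 +
          (rightFactor (m := m) v).coeff ab.2 • ℓ₁ ab.1)) v :=
    HasFDerivAt.fun_sum fun ab _ => (h₁ ab.1).mul (h₂ ab.2)
  have hfun : (fun w => mulMonic m n w i) = fun w : Fin (m + n) → ℝ =>
      ∑ ab ∈ Finset.HasAntidiagonal.antidiagonal (i : ℕ),
        (leftFactor (n := n) w).coeff ab.1 * (rightFactor (m := m) w).coeff ab.2 := by
    funext w
    simp only [mulMonic, lowerCoeffs, coeff_mul]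
  rw [hfun]
  refine h.congr_fderiv ?_
  ext1 w
  have e₁ : ∑ ab ∈ Finset.HasAntidiagonal.antidiagonal (i : ℕ), (leftFactor (n := n) v).coeff ab.1 * ℓ₂ ab.2 w =
      (leftFactor (n := n) v * polyOfCoeffs n (fun j => w (Fin.natAdd m j))).coeff i := by
    rw [coeff_mul]; rfl
  have e₂ : ∑ ab ∈ Finset.HasAntidiagonal.antidiagonal (i : ℕ), (rightFactor (m := m) v).coeff ab.2 * ℓ₁ ab.1 w =
      (rightFactor (m := m) v * polyOfCoeffs m (fun j => w (Fin.castAdd n j))).coeff i := by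
    rw [mul_comm (rightFactor v), coeff_mul]
    exact Finset.sum_congr rfl fun _ _ => mul_comm _ _
  have hl : (leftFactor (n := n) v).natDegree = m := natDegree_toMonic _
  have hr : (rightFactor (m := m) v).natDegree = n := natDegree_toMonic _
  simp only [sum_apply, add_apply,
    smul_apply, smul_eq_mul, Finset.sum_add_distrib, e₁, e₂,
    coeff_mul_polyOfCoeffs, ContinuousLinearMap.comp_apply, ContinuousLinearMap.proj_apply,
    mulMonicDeriv, LinearMap.coe_toContinuousLinearMap', Matrix.toLin'_apply, Matrix.mulVec,
    dotProduct, Fin.sum_univ_add]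
  -- The first `m` Sylvester columns hold coefficients of the right factor, acting on the variation
  -- of the left one; the last `n` do the opposite.
  rw [add_comm]
  congr 1
  · refine Finset.sum_congr rfl fun j _ => ?_
    congr 1
    simp only [sylvester, Matrix.of_apply, Fin.addCases_left, Set.mem_Icc]
    by_cases h1 : (j : ℕ) ≤ i
    · by_cases h2 : (i : ℕ) ≤ j + n
      · simp [h1, h2]
      -- Below the Sylvester band the entry is zero, in agreement with the degree of the factor.
      · rw [if_pos h1, if_neg (by tauto), coeff_eq_zero_of_natDegree_lt]
        omega
    · rw [if_neg h1, if_neg (by tauto)]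
  · refine Finset.sum_congr rfl fun j _ => ?_
    congr 1
    simp only [sylvester, Matrix.of_apply, Fin.addCases_right, Set.mem_Icc]
    by_cases h1 : (j : ℕ) ≤ i
    · by_cases h2 : (i : ℕ) ≤ j + m
      · simp [h1, h2]
      · rw [if_pos h1, if_neg (by tauto), coeff_eq_zero_of_natDegree_lt]
        omega
    · rw [if_neg h1, if_neg (by tauto)]

theorem continuous_coeff_toMonic {n : ℕ} (k : ℕ) :
    Continuous fun c : Fin n → ℝ => (toMonic c).coeff k := by
  simp only [toMonic, coeff_add]
  exact continuous_const.add
    (LinearMap.continuous_of_finiteDimensional (lcoeff ℝ k ∘ₗ polyOfCoeffs n))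

theorem continuous_resultant {Y : Type*} [TopologicalSpace Y] {f g : Y → ℝ[X]} {m n : ℕ}
    (hf : ∀ k, Continuous fun y => (f y).coeff k) (hg : ∀ k, Continuous fun y => (g y).coeff k)
    (hm : ∀ y, (f y).natDegree = m) (hn : ∀ y, (g y).natDegree = n) :
    Continuous fun y => resultant (f y) (g y) := by
  have h : ∀ y, resultant (f y) (g y) = (sylvester (f y) (g y) m n).det := fun y => by
    rw [resultant, hm, hn]
  simp only [h]
  refine Continuous.matrix_det ?_
  refine continuous_matrix fun i j => ?_
  induction j using Fin.addCases with
  | left j =>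
    simp only [sylvester, Matrix.of_apply, Fin.addCases_left]
    split_ifs
    exacts [hg _, continuous_const]
  | right j =>
    simp only [sylvester, Matrix.of_apply, Fin.addCases_right]
    split_ifs
    exacts [hf _, continuous_const]

theorem continuous_det_mulMonicDeriv (m n : ℕ) :
    Continuous fun v => (mulMonicDeriv m n v).det := by
  simp only [det_mulMonicDeriv]
  refine continuous_resultant (m := m) (n := n) (fun k => ?_) (fun k => ?_)
    (fun _ => natDegree_toMonic _) (fun _ => natDegree_toMonic _)
  · exact (continuous_coeff_toMonic k).comp (by fun_prop)
  · exact (continuous_coeff_toMonic k).comp (by fun_prop)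

theorem volume_image_critical_mulMonic (m n : ℕ) :
    volume (mulMonic m n '' {v | (mulMonicDeriv m n v).det = 0}) = 0 :=
  addHaar_image_eq_zero_of_det_fderivWithin_eq_zero volume
    (fun v _ => (hasFDerivAt_mulMonic v).hasFDerivWithinAt) fun _ hv => hv

theorem leftFactor_append {m n : ℕ} (a : Fin m → ℝ) (b : Fin n → ℝ) :
    leftFactor (Fin.append a b) = toMonic a := by
  simp [leftFactor]

theorem rightFactor_append {m n : ℕ} (a : Fin m → ℝ) (b : Fin n → ℝ) :
    rightFactor (Fin.append a b) = toMonic b := by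
  simp [rightFactor]

/-- A product of two non-coprime monic factors is a critical value of `mulMonic`, because the
resultant vanishes there. By Sard's theorem such values are null, and only finitely many degree
splittings occur. -/
theorem ae_squarefree_toMonic (N : ℕ) : ∀ᵐ b : Fin N → ℝ, Squarefree (toMonic b) := by
  have key : ∀ m n : ℕ, ∀ h : m + n = N, ∀ᵐ b : Fin N → ℝ, ∀ r g : ℝ[X], r.Monic → g.Monic →
      r.natDegree = m → g.natDegree = n → toMonic b = r * g → IsCoprime r g := by
    rintro m n rfl
    refine measure_mono_null ?_ (volume_image_critical_mulMonic m n)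
    intro b hb
    simp only [Set.mem_compl_iff, Set.mem_ofPred_eq, not_forall] at hb
    obtain ⟨r, g, hr, hg, hrm, hgn, hbrg, hcop⟩ := hb
    refine ⟨Fin.append (lowerCoeffs m r) (lowerCoeffs n g), ?_, ?_⟩
    · rw [Set.mem_ofPred_eq, det_mulMonicDeriv, leftFactor_append, rightFactor_append,
        toMonic_lowerCoeffs hr hrm, toMonic_lowerCoeffs hg hgn, resultant_eq_zero_iff]
      exact ⟨Or.inl hr.ne_zero, hcop⟩
    · rw [mulMonic, leftFactor_append, rightFactor_append,
        toMonic_lowerCoeffs hr hrm, toMonic_lowerCoeffs hg hgn, ← hbrg, lowerCoeffs_toMonic]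
  have key' : ∀ᵐ b : Fin N → ℝ, ∀ m n : ℕ, ∀ h : m + n = N, ∀ r g : ℝ[X], r.Monic → g.Monic →
      r.natDegree = m → g.natDegree = n → toMonic b = r * g → IsCoprime r g := by
    rw [ae_all_iff]; intro m
    rw [ae_all_iff]; intro n
    by_cases h : m + n = N
    · filter_upwards [key m n h] with b hb _ using hb
    · exact Filter.Eventually.of_forall fun b h' => absurd h' h
  filter_upwards [key'] with b hb
  intro r hr
  obtain ⟨g, hg⟩ := hr
  have hr0 : r ≠ 0 := by
    rintro rfl
    simp only [mul_zero, zero_mul] at hg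
    exact (toMonic_monic b).ne_zero hg
  have hlc : C r.leadingCoeff⁻¹ * C r.leadingCoeff = 1 := by
    rw [← C_mul, inv_mul_cancel₀ (leadingCoeff_ne_zero.2 hr0), C_1]
  -- If `r * r` divides the polynomial, split it between two monic factors that are both multiples
  -- of `r`; the leading coefficient removed from `r'` is absorbed by `g'`.
  set r' := C r.leadingCoeff⁻¹ * r with hr'
  have hr'm : r'.Monic := by
    rw [hr', mul_comm]; exact monic_mul_leadingCoeff_inv hr0
  set g' := C r.leadingCoeff * r * g with hg'
  have hprod : toMonic b = r' * g' := by
    rw [hg, hr', hg']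
    linear_combination (-(r * r * g)) * hlc
  have hg'm : g'.Monic := hr'm.of_mul_monic_left (hprod ▸ toMonic_monic b)
  have hdeg : r'.natDegree + g'.natDegree = N := by
    rw [← hr'm.natDegree_mul hg'm, ← hprod, natDegree_toMonic]
  have hcop := hb _ _ hdeg r' g' hr'm hg'm rfl rfl hprod
  have h1 : r ∣ r' := Dvd.intro_left _ rfl
  have h2 : r ∣ g' := ⟨C r.leadingCoeff * g, by rw [hg']; ring⟩
  exact hcop.isUnit_of_dvd' h1 h2

end MonicCoordinates

/-! ### Roots of real quadratics. -/

section QuadraticRoots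

/-- The discriminant of `X ^ 2 + q 1 * X + q 0`. -/
def quadDisc (q : Fin 2 → ℝ) : ℝ := q 1 ^ 2 - 4 * q 0

/-- The smaller real root, or the root in the lower half plane, of `X ^ 2 + q 1 * X + q 0`. -/
noncomputable def rootFst (q : Fin 2 → ℝ) : ℂ :=
  ⟨(-q 1 - √(quadDisc q)) / 2, -√(-quadDisc q) / 2⟩

/-- The larger real root, or the root in the upper half plane, of `X ^ 2 + q 1 * X + q 0`. -/
noncomputable def rootSnd (q : Fin 2 → ℝ) : ℂ :=
  ⟨(-q 1 + √(quadDisc q)) / 2, √(-quadDisc q) / 2⟩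

/-- The coefficients of `(X - a) * (X - b)`. -/
def quadOfReal (p : ℝ × ℝ) : Fin 2 → ℝ := ![p.1 * p.2, -(p.1 + p.2)]

/-- The coefficients of `(X - conj β) * (X - β)`. -/
def quadOfComplex (β : ℂ) : Fin 2 → ℝ := ![β.re ^ 2 + β.im ^ 2, -(2 * β.re)]

theorem rootFst_add_rootSnd (q : Fin 2 → ℝ) : rootFst q + rootSnd q = -(q 1 : ℂ) := by
  apply Complex.ext <;> simp [rootFst, rootSnd] <;> ring

theorem rootFst_mul_rootSnd (q : Fin 2 → ℝ) : rootFst q * rootSnd q = (q 0 : ℂ) := by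
  -- The real square root vanishes on negative numbers, so at most one of the two radicals is
  -- nonzero and one formula serves both signs of the discriminant.
  have key : √(quadDisc q) ^ 2 - √(-quadDisc q) ^ 2 = quadDisc q ∧
      √(quadDisc q) * √(-quadDisc q) = 0 := by
    rcases le_total 0 (quadDisc q) with h | h
    · rw [Real.sqrt_eq_zero_of_nonpos (neg_nonpos.2 h), Real.sq_sqrt h]; simp
    · rw [Real.sqrt_eq_zero_of_nonpos h, Real.sq_sqrt (neg_nonneg.2 h)]; simp
  obtain ⟨h1, h2⟩ := key
  apply Complex.ext
  · simp only [rootFst, rootSnd, Complex.mul_re, Complex.ofReal_re]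
    rw [quadDisc] at h1 ⊢
    linear_combination (-1 / 4 : ℝ) * h1
  · simp only [rootFst, rootSnd, Complex.mul_im, Complex.ofReal_im]
    linear_combination (-1 / 2 : ℝ) * h2

theorem toMonic_two (q : Fin 2 → ℝ) : toMonic q = X ^ 2 + C (q 1) * X + C (q 0) := by
  simp [toMonic, polyOfCoeffs, Fin.sum_univ_two]; ring

theorem map_toMonic_two (q : Fin 2 → ℝ) :
    (toMonic q).map (algebraMap ℝ ℂ) = (X - C (rootFst q)) * (X - C (rootSnd q)) := by
  have h1 := congrArg (C : ℂ → ℂ[X]) (rootFst_add_rootSnd q)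
  have h2 := congrArg (C : ℂ → ℂ[X]) (rootFst_mul_rootSnd q)
  simp only [C_add, C_mul, C_neg] at h1 h2
  rw [toMonic_two]
  simp only [Polynomial.map_add, Polynomial.map_mul, Polynomial.map_pow, map_X, map_C,
    Complex.coe_algebraMap]
  linear_combination (X : ℂ[X]) * h1 - h2

theorem rootSnd_sub_rootFst_ne_zero {q : Fin 2 → ℝ} (h : quadDisc q ≠ 0) :
    rootSnd q - rootFst q ≠ 0 := by
  intro h0
  have h1 := congrArg Complex.re h0
  have h2 := congrArg Complex.im h0
  simp only [rootSnd, rootFst, Complex.sub_re, Complex.sub_im, Complex.zero_re,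
    Complex.zero_im] at h1 h2
  rcases lt_or_gt_of_ne h with h | h
  · have := Real.sqrt_pos.2 (neg_pos.2 h); linarith
  · have := Real.sqrt_pos.2 h; linarith

theorem quadDisc_quadOfReal (p : ℝ × ℝ) : quadDisc (quadOfReal p) = (p.2 - p.1) ^ 2 := by
  simp [quadDisc, quadOfReal]; ring

theorem quadDisc_quadOfComplex (β : ℂ) : quadDisc (quadOfComplex β) = -(2 * β.im) ^ 2 := by
  simp [quadDisc, quadOfComplex]; ring

theorem rootFst_quadOfReal {p : ℝ × ℝ} (h : p.1 ≤ p.2) : rootFst (quadOfReal p) = p.1 := by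
  have h1 : √((p.2 - p.1) ^ 2) = p.2 - p.1 := Real.sqrt_sq (sub_nonneg.2 h)
  have h2 : √(-(p.2 - p.1) ^ 2) = 0 := Real.sqrt_eq_zero_of_nonpos (by nlinarith [sq_nonneg (p.2 - p.1)])
  apply Complex.ext
  · simp only [rootFst, quadDisc_quadOfReal, h1, Complex.ofReal_re]; simp [quadOfReal]; ring
  · simp only [rootFst, quadDisc_quadOfReal, h2, Complex.ofReal_im]; simp

theorem rootSnd_quadOfReal {p : ℝ × ℝ} (h : p.1 ≤ p.2) : rootSnd (quadOfReal p) = p.2 := by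
  have h1 : √((p.2 - p.1) ^ 2) = p.2 - p.1 := Real.sqrt_sq (sub_nonneg.2 h)
  have h2 : √(-(p.2 - p.1) ^ 2) = 0 := Real.sqrt_eq_zero_of_nonpos (by nlinarith [sq_nonneg (p.2 - p.1)])
  apply Complex.ext
  · simp only [rootSnd, quadDisc_quadOfReal, h1, Complex.ofReal_re]; simp [quadOfReal]; ring
  · simp only [rootSnd, quadDisc_quadOfReal, h2, Complex.ofReal_im]; simp

theorem rootFst_quadOfComplex {β : ℂ} (h : 0 ≤ β.im) :
    rootFst (quadOfComplex β) = starRingEnd ℂ β := by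
  have h1 : √((2 * β.im) ^ 2) = 2 * β.im := Real.sqrt_sq (by linarith)
  have h2 : √(-(2 * β.im) ^ 2) = 0 := Real.sqrt_eq_zero_of_nonpos (by nlinarith [sq_nonneg β.im])
  apply Complex.ext
  · simp only [rootFst, quadDisc_quadOfComplex, h2, Complex.conj_re]; simp [quadOfComplex]
  · simp only [rootFst, quadDisc_quadOfComplex, neg_neg, h1, Complex.conj_im]; ring

theorem rootSnd_quadOfComplex {β : ℂ} (h : 0 ≤ β.im) : rootSnd (quadOfComplex β) = β := by
  have h1 : √((2 * β.im) ^ 2) = 2 * β.im := Real.sqrt_sq (by linarith)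
  have h2 : √(-(2 * β.im) ^ 2) = 0 := Real.sqrt_eq_zero_of_nonpos (by nlinarith [sq_nonneg β.im])
  apply Complex.ext
  · simp only [rootSnd, quadDisc_quadOfComplex, h2]; simp [quadOfComplex]
  · simp only [rootSnd, quadDisc_quadOfComplex, neg_neg, h1]; ring

theorem exists_quadOfReal_of_quadDisc_pos {q : Fin 2 → ℝ} (h : 0 < quadDisc q) :
    ∃ p : ℝ × ℝ, p.1 < p.2 ∧ quadOfReal p = q := by
  have hs := Real.sq_sqrt h.le
  have h0 := Real.sqrt_pos.2 h
  refine ⟨((-q 1 - √(quadDisc q)) / 2, (-q 1 + √(quadDisc q)) / 2), by simp only; linarith, ?_⟩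
  funext i
  fin_cases i
  · simp only [quadOfReal, Fin.zero_eta, Matrix.cons_val_zero]
    rw [quadDisc] at hs ⊢
    linear_combination (-1 / 4 : ℝ) * hs
  · simp only [quadOfReal, Fin.mk_one, Matrix.cons_val_one, Matrix.cons_val_zero]
    ring

theorem exists_quadOfComplex_of_quadDisc_neg {q : Fin 2 → ℝ} (h : quadDisc q < 0) :
    ∃ β : ℂ, 0 < β.im ∧ quadOfComplex β = q := by
  have h' := neg_pos.2 h
  have hs := Real.sq_sqrt h'.le
  have h0 := Real.sqrt_pos.2 h'
  refine ⟨⟨-q 1 / 2, √(-quadDisc q) / 2⟩, by simp only; linarith, ?_⟩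
  funext i
  fin_cases i
  · simp only [quadOfComplex, Fin.zero_eta, Matrix.cons_val_zero]
    rw [quadDisc] at hs ⊢
    linear_combination (1 / 4 : ℝ) * hs
  · simp only [quadOfComplex, Fin.mk_one, Matrix.cons_val_one, Matrix.cons_val_zero]
    ring

theorem exists_sq_of_quadDisc_eq_zero {q : Fin 2 → ℝ} (h : quadDisc q = 0) :
    ∃ a : ℝ, toMonic q = (X - C a) * (X - C a) := by
  refine ⟨-q 1 / 2, ?_⟩
  rw [toMonic_two]
  have h0 : q 0 = (q 1 / 2) ^ 2 := by rw [quadDisc] at h; linarith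
  have h1 : q 1 = 2 * (q 1 / 2) := by ring
  rw [h0, neg_div]
  conv_lhs => rw [h1]
  simp only [C_mul, C_pow, C_neg, C_ofNat]
  have h2 : C (2 * (q 1 / 2) / 2) = C (q 1 / 2) := by congr 1; ring
  rw [h2]
  ring

theorem resultant_toMonic_two (q : Fin 2 → ℝ) (g : ℝ[X]) :
    ((resultant (toMonic q) g : ℝ) : ℂ) =
      (g.map (algebraMap ℝ ℂ)).eval (rootFst q) * (g.map (algebraMap ℝ ℂ)).eval (rootSnd q) := by
  have h := resultant_map_map (toMonic q) g (toMonic q).natDegree g.natDegree (algebraMap ℝ ℂ)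
  have hg : (g.map (algebraMap ℝ ℂ)).natDegree ≤ g.natDegree := natDegree_map_le
  have h3 := resultant_mul_left (X - C (rootFst q)) (X - C (rootSnd q)) (g.map (algebraMap ℝ ℂ))
    g.natDegree hg
  rw [natDegree_X_sub_C, natDegree_X_sub_C, resultant_X_sub_C_left _ _ _ hg,
    resultant_X_sub_C_left _ _ _ hg, ← map_toMonic_two] at h3
  rw [← h3]
  refine h.symm.trans ?_
  rw [natDegree_toMonic]

theorem continuous_quadDisc : Continuous quadDisc := by unfold quadDisc; fun_prop

end QuadraticRoots

/-! ### Signs of resultants and counting of roots. -/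

section FiberCount

theorem Real.sign_mul_eq (x y : ℝ) : Real.sign (x * y) = Real.sign x * Real.sign y := by
  rcases lt_trichotomy x 0 with hx | rfl | hx <;> rcases lt_trichotomy y 0 with hy | rfl | hy <;>
    simp [Real.sign_of_neg, Real.sign_of_pos, *, mul_pos_of_neg_of_neg, mul_neg_of_neg_of_pos,
      mul_neg_of_pos_of_neg]

theorem Real.sign_prod {ι : Type*} (s : Finset ι) (f : ι → ℝ) :
    Real.sign (∏ i ∈ s, f i) = ∏ i ∈ s, Real.sign (f i) := by
  classical
  induction s using Finset.induction_on with
  | empty => simp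
  | insert a s ha ih => rw [Finset.prod_insert ha, Finset.prod_insert ha, Real.sign_mul_eq, ih]

theorem Real.sign_mul_self_of_ne_zero {x : ℝ} (hx : x ≠ 0) : Real.sign x * Real.sign x = 1 := by
  rcases Real.sign_apply_eq_of_ne_zero x hx with h | h <;> simp [h]

/-- The sign at `a` of the derivative of the monic polynomial with simple roots `R`. -/
noncomputable def derivSign (R : Finset ℝ) (a : ℝ) : ℝ := ∏ c ∈ R.erase a, Real.sign (a - c)

theorem derivSign_mul_self (R : Finset ℝ) (a : ℝ) : derivSign R a * derivSign R a = 1 := by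
  rw [derivSign, ← Finset.prod_mul_distrib]
  refine Finset.prod_eq_one fun c hc => Real.sign_mul_self_of_ne_zero ?_
  exact sub_ne_zero.2 (Finset.ne_of_mem_erase hc).symm

/-- The signs alternate, with `+1` at the largest root: adding a new largest root reverses all the
earlier signs and contributes `+1`. -/
theorem sum_derivSign (R : Finset ℝ) :
    ∑ a ∈ R, derivSign R a = if Even R.card then 0 else 1 := by
  induction R using Finset.induction_on_max with
  | empty => simp
  | insert m R hm ih =>
    have hmR : m ∉ R := fun h => lt_irrefl _ (hm m h)
    have h1 : derivSign (insert m R) m = 1 := by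
      rw [derivSign, Finset.erase_insert hmR]
      exact Finset.prod_eq_one fun c hc => Real.sign_of_pos (sub_pos.2 (hm c hc))
    have h2 : ∀ a ∈ R, derivSign (insert m R) a = -derivSign R a := by
      intro a ha
      have hne : m ≠ a := (hm a ha).ne'
      rw [derivSign, Finset.erase_insert_of_ne hne, Finset.prod_insert
        (fun h => hmR (Finset.mem_of_mem_erase h)), Real.sign_of_neg (sub_neg.2 (hm a ha)),
        derivSign, neg_one_mul]
    rw [Finset.sum_insert hmR, h1, Finset.sum_congr rfl h2, Finset.sum_neg_distrib, ih,
      Finset.card_insert_of_notMem hmR]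
    by_cases h : Even R.card <;> simp [h, Nat.even_add_one]

/-- Expand `(∑ e)² = 0`: the diagonal gives `R.card`, and the two off-diagonal halves are equal. -/
theorem sum_filter_lt_neg_mul {R : Finset ℝ} {e : ℝ → ℝ} (he : ∀ a ∈ R, e a * e a = 1)
    (hsum : ∑ a ∈ R, e a = 0) :
    ∑ p ∈ (R ×ˢ R).filter (fun p => p.1 < p.2), -(e p.1 * e p.2) = (R.card : ℝ) / 2 := by
  have h0 : (∑ a ∈ R, e a) * (∑ a ∈ R, e a) = 0 := by rw [hsum, zero_mul]
  have h1 : ∑ a ∈ R, ∑ b ∈ R, e a * e b = (∑ a ∈ R, ∑ b ∈ R, if a < b then e a * e b else 0) +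
      (∑ a ∈ R, ∑ b ∈ R, if b < a then e a * e b else 0) +
      (∑ a ∈ R, ∑ b ∈ R, if a = b then e a * e b else 0) := by
    simp_rw [← Finset.sum_add_distrib]
    refine Finset.sum_congr rfl fun a _ => Finset.sum_congr rfl fun b _ => ?_
    rcases lt_trichotomy a b with h | h | h
    · simp [h, h.not_gt, h.ne]
    · simp [h]
    · simp [h, h.not_gt, h.ne']
  have h2 : (∑ a ∈ R, ∑ b ∈ R, if b < a then e a * e b else 0) =
      ∑ a ∈ R, ∑ b ∈ R, if a < b then e a * e b else 0 := by
    rw [Finset.sum_comm]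
    refine Finset.sum_congr rfl fun a _ => Finset.sum_congr rfl fun b _ => ?_
    rw [mul_comm]
  have h3 : (∑ a ∈ R, ∑ b ∈ R, if a = b then e a * e b else 0) = R.card := by
    rw [Finset.card_eq_sum_ones, Nat.cast_sum]
    refine Finset.sum_congr rfl fun a ha => ?_
    rw [Finset.sum_ite_eq, if_pos ha, he a ha, Nat.cast_one]
  rw [Finset.sum_mul_sum, h1, h2, h3] at h0
  rw [Finset.sum_filter, Finset.sum_product]
  have h4 : (∑ a ∈ R, ∑ b ∈ R, if a < b then -(e a * e b) else 0) =
      -∑ a ∈ R, ∑ b ∈ R, if a < b then e a * e b else 0 := by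
    simp_rw [← Finset.sum_neg_distrib]
    refine Finset.sum_congr rfl fun a _ => Finset.sum_congr rfl fun b _ => ?_
    split_ifs <;> simp
  rw [h4]
  linarith

theorem eval_mul_eval_pos_of_roots_eq_zero {h : ℝ[X]} (h0 : h ≠ 0) (hr : h.roots = 0) (a b : ℝ) :
    0 < h.eval a * h.eval b := by
  have hne : ∀ x, h.eval x ≠ 0 := by
    intro x hx
    have : x ∈ h.roots := (mem_roots h0).2 hx
    simp [hr] at this
  by_contra hle
  have hlt : h.eval a * h.eval b < 0 := lt_of_le_of_ne (not_lt.1 hle) (mul_ne_zero (hne a) (hne b))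
  have hex : (∃ x, h.eval x ≤ 0) ∧ ∃ x, 0 ≤ h.eval x := by
    rcases mul_neg_iff.1 hlt with ⟨h1, h2⟩ | ⟨h1, h2⟩
    · exact ⟨⟨b, h2.le⟩, ⟨a, h1.le⟩⟩
    · exact ⟨⟨a, h1.le⟩, ⟨b, h2.le⟩⟩
  obtain ⟨x, hx⟩ := mem_range_of_exists_le_of_exists_ge h.continuous hex.1 hex.2
  exact hne x hx

theorem eval_map_conj (g : ℝ[X]) (z : ℂ) :
    (g.map (algebraMap ℝ ℂ)).eval (starRingEnd ℂ z) =
      starRingEnd ℂ ((g.map (algebraMap ℝ ℂ)).eval z) := by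
  rw [eval_map_algebraMap, eval_map_algebraMap, aeval_conj]

theorem eval_map_ofReal (g : ℝ[X]) (x : ℝ) :
    (g.map (algebraMap ℝ ℂ)).eval (x : ℂ) = ((g.eval x : ℝ) : ℂ) := by
  rw [← Complex.coe_algebraMap, eval_map_algebraMap, aeval_algebraMap_apply]
  simp

/-- The nonreal roots of a real polynomial in the upper half plane. -/
noncomputable def upperRoots (p : ℝ[X]) : Finset ℂ :=
  (p.map (algebraMap ℝ ℂ)).roots.toFinset.filter fun z => 0 < z.im

theorem mem_upperRoots {p : ℝ[X]} (hp : p ≠ 0) {z : ℂ} :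
    z ∈ upperRoots p ↔ (p.map (algebraMap ℝ ℂ)).eval z = 0 ∧ 0 < z.im := by
  rw [upperRoots, Finset.mem_filter, Multiset.mem_toFinset, mem_roots
    ((Polynomial.map_ne_zero_iff (algebraMap ℝ ℂ).injective).2 hp), IsRoot]

/-- Over `ℂ` all roots are simple, and conjugation exchanges those in the two half planes. -/
theorem card_roots_add_two_mul_card_upperRoots {p : ℝ[X]} (hp : p.Separable) :
    p.roots.toFinset.card + 2 * (upperRoots p).card = p.natDegree := by
  classical
  have hp0 : p ≠ 0 := hp.ne_zero
  set pc := p.map (algebraMap ℝ ℂ) with hpc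
  have hpc0 : pc ≠ 0 := (Polynomial.map_ne_zero_iff (algebraMap ℝ ℂ).injective).2 hp0
  have hmem : ∀ z, z ∈ pc.roots.toFinset ↔ pc.eval z = 0 := fun z => by
    rw [Multiset.mem_toFinset, mem_roots hpc0, IsRoot]
  have hcard : pc.roots.toFinset.card = p.natDegree := by
    rw [Multiset.toFinset_card_of_nodup (nodup_roots hp.map),
      ← (IsAlgClosed.splits pc).natDegree_eq_card_roots, natDegree_map]
  have h1 := Finset.card_filter_add_card_filter_not (s := pc.roots.toFinset) (fun z : ℂ => 0 < z.im)
  have h2 := Finset.card_filter_add_card_filter_not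
    (s := pc.roots.toFinset.filter fun z : ℂ => ¬ 0 < z.im) (fun z : ℂ => z.im < 0)
  have h3 : ((pc.roots.toFinset.filter fun z : ℂ => ¬ 0 < z.im).filter fun z => z.im < 0).card =
      (upperRoots p).card := by
    refine Finset.card_bij' (fun z _ => starRingEnd ℂ z) (fun z _ => starRingEnd ℂ z) ?_ ?_ ?_ ?_
    · intro z hz
      simp only [Finset.mem_filter, hmem] at hz
      rw [mem_upperRoots hp0, eval_map_conj, ← hpc, hz.1.1, Complex.conj_im]
      exact ⟨map_zero _, by linarith [hz.2]⟩
    · intro z hz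
      rw [mem_upperRoots hp0] at hz
      simp only [Finset.mem_filter, hmem]
      rw [hpc, eval_map_conj, hz.1, Complex.conj_im]
      exact ⟨⟨map_zero _, by linarith [hz.2]⟩, by linarith [hz.2]⟩
    · intro z _; simp
    · intro z _; simp
  have h4 : ((pc.roots.toFinset.filter fun z : ℂ => ¬ 0 < z.im).filter
      fun z => ¬ z.im < 0).card = p.roots.toFinset.card := by
    symm
    refine Finset.card_bij (fun a _ => (a : ℂ)) ?_ ?_ ?_
    · intro a ha
      rw [Multiset.mem_toFinset, mem_roots hp0, IsRoot] at ha
      simp only [Finset.mem_filter, hmem, Complex.ofReal_im, lt_irrefl, not_false_eq_true, and_true]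
      rw [hpc, eval_map_ofReal, ha, Complex.ofReal_zero]
    · intro a _ b _ h
      exact_mod_cast h
    · intro z hz
      simp only [Finset.mem_filter, hmem] at hz
      have him : z.im = 0 := le_antisymm (not_lt.1 hz.1.2) (not_lt.1 hz.2)
      have hz' : z = (z.re : ℂ) := Complex.ext rfl (by simp [him])
      refine ⟨z.re, ?_, hz'.symm⟩
      rw [Multiset.mem_toFinset, mem_roots hp0, IsRoot]
      have := hz.1.1
      rw [hpc, hz', eval_map_ofReal] at this
      exact_mod_cast this
  have h5 : (pc.roots.toFinset.filter fun z : ℂ => 0 < z.im).card = (upperRoots p).card := rfl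
  omega

theorem toMonic_quadOfReal (p : ℝ × ℝ) : toMonic (quadOfReal p) = (X - C p.1) * (X - C p.2) := by
  rw [toMonic_two]; simp [quadOfReal]; ring

/-- The resultant is `g(a)g(b)`, while `p'(a) = (a - b)g(a)` and `p'(b) = (b - a)g(b)`; hence the
minus sign. -/
theorem sign_resultant_quadOfReal {p g : ℝ[X]} (hp : p.Separable) {a : ℝ × ℝ} (ha : a.1 < a.2)
    (h : p = toMonic (quadOfReal a) * g) :
    Real.sign (resultant (toMonic (quadOfReal a)) g) =
      -(derivSign p.roots.toFinset a.1 * derivSign p.roots.toFinset a.2) := by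
  classical
  obtain ⟨x, y⟩ := a
  simp only at ha
  have hp0 : p ≠ 0 := hp.ne_zero
  have hres : resultant (toMonic (quadOfReal (x, y))) g = g.eval x * g.eval y := by
    have h1 := resultant_toMonic_two (quadOfReal (x, y)) g
    rw [rootFst_quadOfReal ha.le, rootSnd_quadOfReal ha.le, eval_map_ofReal, eval_map_ofReal] at h1
    exact_mod_cast h1
  rw [toMonic_quadOfReal] at h
  simp only at h
  set R := p.roots.toFinset with hR
  obtain ⟨k, hk1, -, hk3⟩ := exists_prod_multiset_X_sub_C_mul p
  have hk0 : k ≠ 0 := by rintro rfl; exact hp0 (by rw [← hk1, mul_zero])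
  have hRv : R.val = p.roots := by
    rw [hR, Multiset.toFinset_val, (nodup_roots hp).dedup]
  have hprod : (p.roots.map fun a => X - C a).prod = ∏ c ∈ R, (X - C c) := by
    rw [Finset.prod, hRv]
  rw [hprod] at hk1
  have hx : x ∈ R := by
    rw [hR, Multiset.mem_toFinset, mem_roots hp0, IsRoot, h]; simp
  have hy : y ∈ R.erase x := by
    rw [Finset.mem_erase, hR, Multiset.mem_toFinset, mem_roots hp0, IsRoot, h]
    exact ⟨ha.ne', by simp⟩
  have hy' : y ∈ R := Finset.mem_of_mem_erase hy
  have hx' : x ∈ R.erase y := Finset.mem_erase.2 ⟨ha.ne, hx⟩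
  have hg : g = (∏ c ∈ (R.erase x).erase y, (X - C c)) * k := by
    have hne : (X - C x) * (X - C y) ≠ 0 := mul_ne_zero (X_sub_C_ne_zero x) (X_sub_C_ne_zero y)
    refine mul_left_cancel₀ hne ?_
    rw [← h, ← hk1, ← Finset.mul_prod_erase R _ hx, ← Finset.mul_prod_erase (R.erase x) _ hy]
    ring
  -- The factor without real roots has constant sign on the line, so it does not affect the sign of
  -- `g(a)g(b)`.
  have hkpos := eval_mul_eval_pos_of_roots_eq_zero hk0 hk3 x y
  have e1 : derivSign R x = -∏ c ∈ (R.erase x).erase y, Real.sign (x - c) := by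
    rw [derivSign, ← Finset.mul_prod_erase _ _ hy, Real.sign_of_neg (sub_neg.2 ha), neg_one_mul]
  have e2 : derivSign R y = ∏ c ∈ (R.erase x).erase y, Real.sign (y - c) := by
    rw [derivSign, ← Finset.mul_prod_erase _ _ hx', Real.sign_of_pos (sub_pos.2 ha), one_mul,
      Finset.erase_right_comm]
  rw [hres, e1, e2, hg, eval_mul, eval_mul, eval_prod, eval_prod]
  simp only [eval_sub, eval_X, eval_C]
  rw [mul_mul_mul_comm, Real.sign_mul_eq, Real.sign_of_pos hkpos, Real.sign_mul_eq, Real.sign_prod,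
    Real.sign_prod]
  ring

/-- At conjugate roots the resultant is `|g(β)|²`, which is nonzero by separability. -/
theorem sign_resultant_quadOfComplex {p g : ℝ[X]} (hp : p.Separable) {β : ℂ} (hβ : 0 < β.im)
    (h : p = toMonic (quadOfComplex β) * g) :
    Real.sign (resultant (toMonic (quadOfComplex β)) g) = 1 := by
  have h1 := resultant_toMonic_two (quadOfComplex β) g
  rw [rootFst_quadOfComplex hβ.le, rootSnd_quadOfComplex hβ.le, eval_map_conj,
    ← Complex.normSq_eq_conj_mul_self] at h1
  have h2 : resultant (toMonic (quadOfComplex β)) g ≠ 0 := by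
    intro h0
    exact (resultant_eq_zero_iff.1 h0).2 (by rw [h] at hp; exact hp.isCoprime)
  have h3 := Complex.ofReal_injective h1
  refine Real.sign_of_pos (lt_of_le_of_ne ?_ h2.symm)
  rw [h3]
  exact Complex.normSq_nonneg _

theorem toMonic_quadOfReal_dvd {p : ℝ[X]} {a : ℝ × ℝ} (ha : a.1 < a.2) (h1 : p.eval a.1 = 0)
    (h2 : p.eval a.2 = 0) : toMonic (quadOfReal a) ∣ p := by
  rw [toMonic_quadOfReal]
  exact (isCoprime_X_sub_C_of_isUnit_sub (sub_ne_zero.2 ha.ne).isUnit).mul_dvd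
    (dvd_iff_isRoot.2 h1) (dvd_iff_isRoot.2 h2)

theorem toMonic_quadOfComplex_dvd {p : ℝ[X]} {β : ℂ} (hβ : 0 < β.im)
    (h : (p.map (algebraMap ℝ ℂ)).eval β = 0) : toMonic (quadOfComplex β) ∣ p := by
  rw [eval_map_algebraMap] at h
  have := p.quadratic_dvd_of_aeval_eq_zero_im_ne_zero h hβ.ne'
  convert this using 1
  rw [toMonic_two, ← Complex.normSq_eq_norm_sq, Complex.normSq_apply]
  simp [quadOfComplex]; ring

end FiberCount

/-! ### Splitting off one quadratic factor. -/

section TwoFactorFormula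

/-- The factorization of `p` with first factor `toMonic q`, in coordinates. -/
noncomputable def factorAt (n : ℕ) (p : ℝ[X]) (q : Fin 2 → ℝ) : Fin (2 + n) → ℝ :=
  Fin.append q (lowerCoeffs n (p /ₘ toMonic q))

theorem toMonic_injective {n : ℕ} : Function.Injective (toMonic : (Fin n → ℝ) → ℝ[X]) := by
  intro c d h
  rw [← lowerCoeffs_toMonic c, h, lowerCoeffs_toMonic]

theorem factorAt_injective (n : ℕ) (p : ℝ[X]) : Function.Injective (factorAt n p) := by
  intro q r h
  funext i
  have := congrFun h (Fin.castAdd n i)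
  simpa [factorAt] using this

theorem factorAt_of_mulMonic_eq {n : ℕ} {b v : Fin (2 + n) → ℝ} (h : mulMonic 2 n v = b) :
    factorAt n (toMonic b) (fun i => v (Fin.castAdd n i)) = v := by
  have h1 : toMonic b = toMonic (fun i : Fin 2 => v (Fin.castAdd n i)) *
      toMonic (fun i : Fin n => v (Fin.natAdd 2 i)) := by
    rw [← h, toMonic_mulMonic]; rfl
  rw [factorAt, h1, mul_divByMonic_cancel_left _ (toMonic_monic _), lowerCoeffs_toMonic]
  exact Fin.append_castAdd_natAdd

theorem exists_cofactor_of_toMonic_dvd {n : ℕ} {b : Fin (2 + n) → ℝ} {q : Fin 2 → ℝ}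
    (h : toMonic q ∣ toMonic b) :
    ∃ g : ℝ[X], toMonic b = toMonic q * g ∧ mulMonic 2 n (factorAt n (toMonic b) q) = b ∧
      (mulMonicDeriv 2 n (factorAt n (toMonic b) q)).det = resultant (toMonic q) g := by
  obtain ⟨g, hg⟩ := h
  have hgm : g.Monic := (toMonic_monic q).of_mul_monic_left (hg ▸ toMonic_monic b)
  have hgn : g.natDegree = n := by
    have := congrArg natDegree hg
    rw [(toMonic_monic q).natDegree_mul hgm, natDegree_toMonic, natDegree_toMonic] at this
    omega
  have hq : toMonic b /ₘ toMonic q = g := by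
    rw [hg, mul_divByMonic_cancel_left _ (toMonic_monic _)]
  refine ⟨g, hg, ?_, ?_⟩
  · rw [mulMonic, factorAt, hq, leftFactor_append, rightFactor_append,
      toMonic_lowerCoeffs hgm hgn, ← hg, lowerCoeffs_toMonic]
  · rw [det_mulMonicDeriv, factorAt, hq, leftFactor_append, rightFactor_append,
      toMonic_lowerCoeffs hgm hgn]

/-- The fibre is indexed by the monic quadratic divisors: pairs of real roots in increasing order
and roots in the upper half plane. Evenness of `n` makes the number of real roots even, so their
alternating signs cancel. The cardinality bound is deliberately crude; it only has to depend on `n`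
alone. -/
theorem exists_fiber_mulMonic {n : ℕ} (hn : Even n) {b : Fin (2 + n) → ℝ}
    (hb : (toMonic b).Separable) :
    ∃ S : Finset (Fin (2 + n) → ℝ), (∀ v, mulMonic 2 n v = b → v ∈ S) ∧
      (∀ v ∈ S, mulMonic 2 n v = b) ∧
      ∑ v ∈ S, Real.sign (mulMonicDeriv 2 n v).det = (2 + n : ℝ) / 2 ∧
      S.card ≤ (2 + n) ^ 2 + (2 + n) := by
  classical
  set p := toMonic b with hp
  have hp0 : p ≠ 0 := (toMonic_monic b).ne_zero
  set R := p.roots.toFinset with hR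
  set U := upperRoots p with hU
  have hcard : R.card + 2 * U.card = 2 + n := by
    rw [hR, hU, card_roots_add_two_mul_card_upperRoots hb, hp, natDegree_toMonic]
  have hRe : Even R.card := by
    obtain ⟨k, hk⟩ := hn
    exact ⟨1 + k - U.card, by omega⟩
  set P := (R ×ˢ R).filter (fun a => a.1 < a.2) with hP
  have hmemR : ∀ x, x ∈ R ↔ p.eval x = 0 := fun x => by
    rw [hR, Multiset.mem_toFinset, mem_roots hp0, IsRoot]
  set θ : (ℝ × ℝ) ⊕ ℂ → (Fin (2 + n) → ℝ) := fun i =>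
    factorAt n p (Sum.elim quadOfReal quadOfComplex i) with hθ
  have hdvd₁ : ∀ a ∈ P, toMonic (quadOfReal a) ∣ p := by
    intro a ha
    rw [hP, Finset.mem_filter, Finset.mem_product, hmemR, hmemR] at ha
    exact toMonic_quadOfReal_dvd ha.2 ha.1.1 ha.1.2
  have hdvd₂ : ∀ β ∈ U, toMonic (quadOfComplex β) ∣ p := by
    intro β hβ
    rw [hU, mem_upperRoots hp0] at hβ
    exact toMonic_quadOfComplex_dvd hβ.2 hβ.1
  have hPlt : ∀ a ∈ P, a.1 < a.2 := fun a ha => (Finset.mem_filter.1 ha).2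
  have hUpos : ∀ β ∈ U, 0 < β.im := fun β hβ => (Finset.mem_filter.1 hβ).2
  -- The ordered roots recover the index, and a real pair differs from a conjugate pair by the
  -- imaginary part of `rootSnd`.
  have hinj : Set.InjOn θ (P.disjSum U : Finset _) := by
    intro i hi j hj hij
    have h1 : Sum.elim quadOfReal quadOfComplex i = Sum.elim quadOfReal quadOfComplex j :=
      factorAt_injective n p hij
    have h2 := congrArg rootFst h1
    have h3 := congrArg rootSnd h1
    rw [Finset.mem_coe] at hi hj
    rcases i with a | β <;> rcases j with a' | β' <;>
      simp only [Finset.inl_mem_disjSum, Finset.inr_mem_disjSum] at hi hj <;>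
      simp only [Sum.elim_inl, Sum.elim_inr] at h2 h3
    · rw [rootFst_quadOfReal (hPlt _ hi).le, rootFst_quadOfReal (hPlt _ hj).le] at h2
      rw [rootSnd_quadOfReal (hPlt _ hi).le, rootSnd_quadOfReal (hPlt _ hj).le] at h3
      exact congrArg _ (Prod.ext (by exact_mod_cast h2) (by exact_mod_cast h3))
    · rw [rootSnd_quadOfReal (hPlt _ hi).le, rootSnd_quadOfComplex (hUpos _ hj).le] at h3
      have := hUpos _ hj
      rw [← h3, Complex.ofReal_im] at this
      exact absurd this (lt_irrefl _)
    · rw [rootSnd_quadOfReal (hPlt _ hj).le, rootSnd_quadOfComplex (hUpos _ hi).le] at h3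
      have := hUpos _ hi
      rw [h3, Complex.ofReal_im] at this
      exact absurd this (lt_irrefl _)
    · rw [rootSnd_quadOfComplex (hUpos _ hi).le, rootSnd_quadOfComplex (hUpos _ hj).le] at h3
      exact congrArg _ h3
  refine ⟨(P.disjSum U).image θ, ?_, ?_, ?_, ?_⟩
  · intro v hv
    set q : Fin 2 → ℝ := fun i => v (Fin.castAdd n i) with hq
    have hvq : factorAt n p q = v := factorAt_of_mulMonic_eq hv
    have hpv : p = toMonic q * rightFactor v := by rw [hp, ← hv, toMonic_mulMonic]; rfl
    rw [Finset.mem_image]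
    rcases lt_trichotomy (quadDisc q) 0 with h | h | h
    · obtain ⟨β, hβ, hβq⟩ := exists_quadOfComplex_of_quadDisc_neg h
      refine ⟨Sum.inr β, ?_, by rw [hθ]; simp only [Sum.elim_inr]; rw [hβq, hvq]⟩
      rw [Finset.inr_mem_disjSum, hU, mem_upperRoots hp0, hpv, Polynomial.map_mul, eval_mul,
        map_toMonic_two, ← hβq, rootSnd_quadOfComplex hβ.le]
      exact ⟨by simp, hβ⟩
    · obtain ⟨a, ha⟩ := exists_sq_of_quadDisc_eq_zero h
      have hsq := hb.squarefree
      have := hsq (X - C a) (by rw [hpv, ha]; exact dvd_mul_right _ _)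
      exact absurd this (not_isUnit_X_sub_C a)
    · obtain ⟨a, ha, haq⟩ := exists_quadOfReal_of_quadDisc_pos h
      refine ⟨Sum.inl a, ?_, by rw [hθ]; simp only [Sum.elim_inl]; rw [haq, hvq]⟩
      rw [Finset.inl_mem_disjSum, hP, Finset.mem_filter, Finset.mem_product, hmemR, hmemR, hpv,
        ← haq, toMonic_quadOfReal]
      exact ⟨⟨by simp, by simp⟩, ha⟩
  · intro v hv
    obtain ⟨i, hi, rfl⟩ := Finset.mem_image.1 hv
    rcases i with a | β
    · obtain ⟨g, -, h, -⟩ := exists_cofactor_of_toMonic_dvd (hdvd₁ a (Finset.inl_mem_disjSum.1 hi))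
      exact h
    · obtain ⟨g, -, h, -⟩ := exists_cofactor_of_toMonic_dvd (hdvd₂ β (Finset.inr_mem_disjSum.1 hi))
      exact h
  · rw [Finset.sum_image hinj, Finset.sum_disjSum]
    have h1 : ∀ a ∈ P, Real.sign (mulMonicDeriv 2 n (θ (Sum.inl a))).det =
        -(derivSign R a.1 * derivSign R a.2) := by
      intro a ha
      obtain ⟨g, hg, -, h⟩ := exists_cofactor_of_toMonic_dvd (hdvd₁ a ha)
      rw [hθ]
      simp only [Sum.elim_inl]
      rw [h, sign_resultant_quadOfReal hb (hPlt a ha) hg]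
    have h2 : ∀ β ∈ U, Real.sign (mulMonicDeriv 2 n (θ (Sum.inr β))).det = 1 := by
      intro β hβ
      obtain ⟨g, hg, -, h⟩ := exists_cofactor_of_toMonic_dvd (hdvd₂ β hβ)
      rw [hθ]
      simp only [Sum.elim_inr]
      rw [h, sign_resultant_quadOfComplex hb (hUpos β hβ) hg]
    rw [Finset.sum_congr rfl h1, Finset.sum_congr rfl h2,
      -- The real pairs contribute half the number of real roots and the conjugate pairs one each:
      -- half the degree in total.
      sum_filter_lt_neg_mul (fun a _ => derivSign_mul_self R a) (by rw [sum_derivSign, if_pos hRe])]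
    have : (R.card : ℝ) + 2 * U.card = 2 + n := by exact_mod_cast hcard
    simp only [Finset.sum_const, nsmul_eq_mul, mul_one]
    linarith
  · refine Finset.card_image_le.trans ?_
    rw [Finset.card_disjSum]
    have h1 : P.card ≤ R.card * R.card := by
      rw [← Finset.card_product]; exact Finset.card_filter_le _ _
    have h2 : R.card ≤ 2 + n := by omega
    have h3 : R.card * R.card ≤ (2 + n) ^ 2 := by rw [sq]; exact Nat.mul_le_mul h2 h2
    omega

theorem measurePreserving_append (m n : ℕ) :
    MeasurePreserving (fun p : (Fin m → ℝ) × (Fin n → ℝ) => Fin.append p.1 p.2) := by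
  have h1 := (volume_measurePreserving_sumPiEquivProdPi_symm
    (fun _ : Fin m ⊕ Fin n => ℝ))
  have h2 := volume_measurePreserving_piCongrLeft (fun _ : Fin (m + n) => ℝ)
    (finSumFinEquiv (m := m) (n := n))
  have h : (fun p : (Fin m → ℝ) × (Fin n → ℝ) => Fin.append p.1 p.2) =
      MeasurableEquiv.piCongrLeft (fun _ : Fin (m + n) => ℝ) finSumFinEquiv ∘
        (MeasurableEquiv.sumPiEquivProdPi fun _ : Fin m ⊕ Fin n => ℝ).symm := by
    funext p i
    obtain ⟨j, rfl⟩ := finSumFinEquiv.surjective i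
    rw [Function.comp_apply, MeasurableEquiv.coe_piCongrLeft, Equiv.piCongrLeft_apply_apply]
    rcases j with j | j
    · simp [MeasurableEquiv.sumPiEquivProdPi, Equiv.sumPiEquivProdPi]
    · simp [MeasurableEquiv.sumPiEquivProdPi, Equiv.sumPiEquivProdPi]
  rw [h]
  exact h2.comp h1

theorem measurableEmbedding_append (m n : ℕ) :
    MeasurableEmbedding (fun p : (Fin m → ℝ) × (Fin n → ℝ) => Fin.append p.1 p.2) := by
  have hc : Continuous (fun p : (Fin m → ℝ) × (Fin n → ℝ) => Fin.append p.1 p.2) := by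
    refine continuous_pi fun i => ?_
    refine Fin.addCases (fun j => ?_) (fun j => ?_) i
    · simp only [Fin.append_left]; fun_prop
    · simp only [Fin.append_right]; fun_prop
  refine hc.measurableEmbedding ?_
  rintro ⟨a, b⟩ ⟨c, d⟩ h
  have h1 : a = c := funext fun i => by simpa using congrFun h (Fin.castAdd n i)
  have h2 : b = d := funext fun i => by simpa using congrFun h (Fin.natAdd m i)
  rw [h1, h2]

theorem integral_resultant_mul_quadratic_factor {n : ℕ} (hn : Even n) {f : ℝ[X] → ℂ}
    (hf : Integrable fun c : Fin (2 + n) → ℝ => f (toMonic c)) :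
    Integrable (fun p : (Fin 2 → ℝ) × (Fin n → ℝ) =>
      ((resultant (toMonic p.1) (toMonic p.2) : ℝ) : ℂ) * f (toMonic p.1 * toMonic p.2)) ∧
    ∫ p : (Fin 2 → ℝ) × (Fin n → ℝ),
      ((resultant (toMonic p.1) (toMonic p.2) : ℝ) : ℂ) * f (toMonic p.1 * toMonic p.2) =
        (2 + n : ℂ) / 2 * ∫ c : Fin (2 + n) → ℝ, f (toMonic c) ∧
    ∫ p : (Fin 2 → ℝ) × (Fin n → ℝ),
      ‖((resultant (toMonic p.1) (toMonic p.2) : ℝ) : ℂ) * f (toMonic p.1 * toMonic p.2)‖ ≤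
        ((2 + n) ^ 2 + (2 + n) : ℕ) * ∫ c : Fin (2 + n) → ℝ, ‖f (toMonic c)‖ := by
  have hfib : ∀ᵐ b : Fin (2 + n) → ℝ, ∃ S : Finset (Fin (2 + n) → ℝ),
      (∀ v, mulMonic 2 n v = b → v ∈ S) ∧ (∀ v ∈ S, mulMonic 2 n v = b) ∧
      ∑ v ∈ S, Real.sign (mulMonicDeriv 2 n v).det = (2 + n : ℝ) / 2 ∧
      S.card ≤ (2 + n) ^ 2 + (2 + n) := by
    filter_upwards [ae_squarefree_toMonic (2 + n)] with b hb
    exact exists_fiber_mulMonic hn (PerfectField.separable_iff_squarefree.2 hb)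
  obtain ⟨h1, h2, h3⟩ := integral_det_mul_comp_of_signed_fiber_card volume
    (fun v => hasFDerivAt_mulMonic v) (continuous_det_mulMonicDeriv 2 n).measurable hfib hf
  have hmp := measurePreserving_append 2 n
  have hme := measurableEmbedding_append 2 n
  have hcomp : ∀ p : (Fin 2 → ℝ) × (Fin n → ℝ),
      (((mulMonicDeriv 2 n (Fin.append p.1 p.2)).det : ℝ) : ℂ) *
        f (toMonic (mulMonic 2 n (Fin.append p.1 p.2))) =
      ((resultant (toMonic p.1) (toMonic p.2) : ℝ) : ℂ) * f (toMonic p.1 * toMonic p.2) := by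
    intro p
    rw [det_mulMonicDeriv, toMonic_mulMonic, leftFactor_append, rightFactor_append]
  rw [← hmp.integrable_comp_emb hme] at h1
  rw [← hmp.integral_comp hme] at h2 h3
  simp only [Function.comp_def, hcomp] at h1 h2 h3
  refine ⟨h1, ?_, ?_⟩
  · rw [h2]; push_cast; rfl
  · exact h3

end TwoFactorFormula

/-! ### Factorization into quadratics. -/

section QuadraticFactorization

theorem continuous_coeff_mul {Y : Type*} [TopologicalSpace Y] {f g : Y → ℝ[X]}
    (hf : ∀ k, Continuous fun y => (f y).coeff k) (hg : ∀ k, Continuous fun y => (g y).coeff k)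
    (k : ℕ) : Continuous fun y => (f y * g y).coeff k := by
  simp only [coeff_mul]
  exact continuous_finsetSum _ fun ab _ => (hf ab.1).mul (hg ab.2)

theorem continuous_coeff_prod {Y ι : Type*} [TopologicalSpace Y] (s : Finset ι) {f : ι → Y → ℝ[X]}
    (hf : ∀ i k, Continuous fun y => (f i y).coeff k) (k : ℕ) :
    Continuous fun y => (∏ i ∈ s, f i y).coeff k := by
  classical
  induction s using Finset.induction_on generalizing k with
  | empty => simp only [Finset.prod_empty]; exact continuous_const
  | insert a s ha ih =>
    simp only [Finset.prod_insert ha]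
    exact continuous_coeff_mul (hf a) ih k

theorem continuous_comp_of_continuous_toMonic {Y : Type*} [TopologicalSpace Y] {N : ℕ}
    {f : ℝ[X] → ℂ} (hf : Continuous fun c : Fin N → ℝ => f (toMonic c)) {p : Y → ℝ[X]}
    (hp : ∀ k, Continuous fun y => (p y).coeff k) (hm : ∀ y, (p y).Monic)
    (hd : ∀ y, (p y).natDegree = N) : Continuous fun y => f (p y) := by
  have h : (fun y => f (p y)) = fun y => f (toMonic (lowerCoeffs N (p y))) := by
    funext y
    rw [toMonic_lowerCoeffs (hm y) (hd y)]
  rw [h]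
  exact hf.comp (continuous_pi fun i => hp i)

/-- The product of the resultants of pairs of quadratic factors. -/
noncomputable def resultantProd {J : ℕ} (q : Fin J → Fin 2 → ℝ) : ℝ :=
  ∏ i, ∏ j ∈ Finset.Ioi i, resultant (toMonic (q i)) (toMonic (q j))

/-- The pull back of `f` to products of quadratic polynomials, with the Jacobian factor. -/
noncomputable def quadPullback (f : ℝ[X] → ℂ) {J : ℕ} (q : Fin J → Fin 2 → ℝ) : ℂ :=
  ((resultantProd q : ℝ) : ℂ) * f (∏ i, toMonic (q i))

theorem resultantProd_cons {J : ℕ} (q : Fin 2 → ℝ) (r : Fin J → Fin 2 → ℝ) :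
    resultantProd (Fin.cons q r : Fin (J + 1) → Fin 2 → ℝ) =
      resultant (toMonic q) (∏ i, toMonic (r i)) * resultantProd r := by
  have hlc : ∏ i : Fin J, (toMonic (r i)).leadingCoeff ≠ 0 := by
    rw [Finset.prod_eq_one fun i _ => (toMonic_monic (r i)).leadingCoeff]
    exact one_ne_zero
  rw [resultantProd, Fin.prod_univ_succ, Fin.prod_Ioi_zero]
  simp only [Fin.prod_Ioi_succ, Fin.cons_zero, Fin.cons_succ]
  rw [resultantProd, resultant_prod_right _ _ _ _ le_rfl hlc]
  rfl

theorem quadPullback_cons (f : ℝ[X] → ℂ) {J : ℕ} (q : Fin 2 → ℝ) (r : Fin J → Fin 2 → ℝ) :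
    quadPullback f (Fin.cons q r : Fin (J + 1) → Fin 2 → ℝ) =
      quadPullback (fun g => ((resultant (toMonic q) g : ℝ) : ℂ) * f (toMonic q * g)) r := by
  rw [quadPullback, quadPullback, resultantProd_cons, Fin.prod_univ_succ]
  simp only [Fin.cons_zero, Fin.cons_succ]
  push_cast
  ring

theorem natDegree_prod_toMonic_two {J : ℕ} (q : Fin J → Fin 2 → ℝ) :
    (∏ i, toMonic (q i)).natDegree = 2 * J := by
  rw [natDegree_prod_of_monic _ _ fun i _ => toMonic_monic (q i)]
  simp [natDegree_toMonic, mul_comm]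

theorem continuous_quadPullback {J : ℕ} {f : ℝ[X] → ℂ}
    (hf : Continuous fun c : Fin (2 * J) → ℝ => f (toMonic c)) :
    Continuous fun q : Fin J → Fin 2 → ℝ => quadPullback f q := by
  have hc : ∀ (i : Fin J) (k : ℕ),
      Continuous fun q : Fin J → Fin 2 → ℝ => (toMonic (q i)).coeff k :=
    fun i k => (continuous_coeff_toMonic k).comp (continuous_apply i)
  refine Continuous.mul ?_ ?_
  · refine Complex.continuous_ofReal.comp ?_
    exact continuous_finsetProd _ fun i _ => continuous_finsetProd _ fun j _ =>
      continuous_resultant (hc i) (hc j) (fun _ => natDegree_toMonic _)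
        (fun _ => natDegree_toMonic _)
  · exact continuous_comp_of_continuous_toMonic hf (continuous_coeff_prod _ hc)
      (fun q => monic_prod_of_monic _ _ fun i _ => toMonic_monic (q i))
      (fun q => natDegree_prod_toMonic_two q)

/-- Peeling one quadratic off degree `2(J + 1)` costs the factor `J + 1`, whence `J!`. The induction
hypothesis is applied to every slice `F q`, so `K` must be uniform in `f`: the resulting `L¹` bound
is what justifies Fubini. Continuity supplies the joint measurability. -/
theorem integral_quadPullback (J : ℕ) : ∃ K : ℝ, 0 ≤ K ∧ ∀ f : ℝ[X] → ℂ,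
    (Continuous fun c : Fin (2 * J) → ℝ => f (toMonic c)) →
    (Integrable fun c : Fin (2 * J) → ℝ => f (toMonic c)) →
    (Integrable fun q : Fin J → Fin 2 → ℝ => quadPullback f q) ∧
    ∫ q : Fin J → Fin 2 → ℝ, quadPullback f q =
      (J.factorial : ℂ) * ∫ c : Fin (2 * J) → ℝ, f (toMonic c) ∧
    ∫ q : Fin J → Fin 2 → ℝ, ‖quadPullback f q‖ ≤
      K * ∫ c : Fin (2 * J) → ℝ, ‖f (toMonic c)‖ := by
  induction J with
  | zero =>
    refine ⟨1, zero_le_one, fun f _ _ => ?_⟩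
    have h1 : ∀ q : Fin 0 → Fin 2 → ℝ, quadPullback f q = f 1 := fun q => by
      simp [quadPullback, resultantProd]
    have h2 : ∀ c : Fin (2 * 0) → ℝ, f (toMonic c) = f 1 := fun c => by
      simp [toMonic, polyOfCoeffs]
    -- On a space of dimension zero both measures are unit point masses.
    have h3 : (volume : Measure (Fin 0 → Fin 2 → ℝ)) = Measure.dirac 0 := by
      rw [volume_pi, Measure.pi_of_empty _ 0]
    have h4 : (volume : Measure (Fin (2 * 0) → ℝ)) = Measure.dirac 0 := by
      rw [volume_pi]; exact Measure.pi_of_empty (α := Fin 0) _ 0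
    simp only [h1, h2, h3, h4]
    refine ⟨integrable_const _, ?_, ?_⟩ <;> simp
  | succ J ih =>
    obtain ⟨K, hK0, ih⟩ := ih
    refine ⟨K * ((2 + 2 * J) ^ 2 + (2 + 2 * J) : ℕ), by positivity, ?_⟩
    intro f hcont hint
    have key : ∀ N : ℕ, N = 2 + 2 * J →
        (Continuous fun c : Fin N → ℝ => f (toMonic c)) →
        (Integrable fun c : Fin N → ℝ => f (toMonic c)) →
        (Continuous fun c : Fin (2 + 2 * J) → ℝ => f (toMonic c)) ∧
        (Integrable fun c : Fin (2 + 2 * J) → ℝ => f (toMonic c)) ∧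
        (∫ c : Fin N → ℝ, f (toMonic c)) = (∫ c : Fin (2 + 2 * J) → ℝ, f (toMonic c)) ∧
        (∫ c : Fin N → ℝ, ‖f (toMonic c)‖) = (∫ c : Fin (2 + 2 * J) → ℝ, ‖f (toMonic c)‖) := by
      rintro _ rfl h1 h2
      exact ⟨h1, h2, rfl, rfl⟩
    obtain ⟨hcont', hint', hI, hIn⟩ := key _ (by ring) hcont hint
    rw [hI, hIn]
    obtain ⟨h1, h2, h3⟩ := integral_resultant_mul_quadratic_factor (even_two_mul J) hint'
    set F : (Fin 2 → ℝ) → ℝ[X] → ℂ := fun q g =>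
      ((resultant (toMonic q) g : ℝ) : ℂ) * f (toMonic q * g) with hF
    change Integrable (fun p : (Fin 2 → ℝ) × (Fin (2 * J) → ℝ) => F p.1 (toMonic p.2)) at h1
    change ∫ p : (Fin 2 → ℝ) × (Fin (2 * J) → ℝ), F p.1 (toMonic p.2) = _ at h2
    change ∫ p : (Fin 2 → ℝ) × (Fin (2 * J) → ℝ), ‖F p.1 (toMonic p.2)‖ ≤ _ at h3
    have hFcont : ∀ q, Continuous fun c : Fin (2 * J) → ℝ => F q (toMonic c) := by
      intro q
      refine Continuous.mul ?_ ?_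
      · exact Complex.continuous_ofReal.comp (continuous_resultant (fun _ => continuous_const)
          continuous_coeff_toMonic (fun _ => natDegree_toMonic _) (fun _ => natDegree_toMonic _))
      · refine continuous_comp_of_continuous_toMonic hcont'
          (continuous_coeff_mul (fun _ => continuous_const) continuous_coeff_toMonic)
          (fun c => (toMonic_monic q).mul (toMonic_monic c)) (fun c => ?_)
        rw [(toMonic_monic q).natDegree_mul (toMonic_monic c), natDegree_toMonic,
          natDegree_toMonic]
    -- Integrability on the product passes to almost every slice only, so the induction hypothesis
    -- is used almost everywhere in `q`.
    have hslice : ∀ᵐ q : Fin 2 → ℝ, Integrable fun c : Fin (2 * J) → ℝ => F q (toMonic c) :=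
      h1.prod_right_ae
    let e := MeasurableEquiv.piFinSuccAbove (fun _ : Fin (J + 1) => Fin 2 → ℝ) 0
    have hmp : MeasurePreserving e.symm :=
      (volume_preserving_piFinSuccAbove (fun _ : Fin (J + 1) => Fin 2 → ℝ) 0).symm e
    have he : ∀ p : (Fin 2 → ℝ) × (Fin J → Fin 2 → ℝ),
        quadPullback f (e.symm p) = quadPullback (F p.1) p.2 := by
      intro p
      have : e.symm p = Fin.cons p.1 p.2 := by
        simp [e, MeasurableEquiv.piFinSuccAbove, Fin.insertNthEquiv]
      rw [this, quadPullback_cons]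
    have hmeas : AEStronglyMeasurable (fun p : (Fin 2 → ℝ) × (Fin J → Fin 2 → ℝ) =>
        quadPullback (F p.1) p.2) volume := by
      have h := ((continuous_quadPullback hcont).measurable.comp
        e.symm.measurable).aestronglyMeasurable (μ := volume)
      refine h.congr (Filter.Eventually.of_forall fun p => he p)
    have hnormint : Integrable fun q : Fin 2 → ℝ =>
        ∫ r : Fin J → Fin 2 → ℝ, ‖quadPullback (F q) r‖ := by
      refine Integrable.mono' (h1.norm.integral_prod_left.const_mul K)
        hmeas.norm.integral_prod_right' ?_
      filter_upwards [hslice] with q hq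
      rw [Real.norm_of_nonneg (integral_nonneg fun _ => norm_nonneg _)]
      exact (ih (F q) (hFcont q) hq).2.2
    have hprod : Integrable (fun p : (Fin 2 → ℝ) × (Fin J → Fin 2 → ℝ) =>
        quadPullback (F p.1) p.2) := by
      refine (integrable_prod_iff hmeas).2 ⟨?_, hnormint⟩
      filter_upwards [hslice] with q hq
      exact (ih (F q) (hFcont q) hq).1
    refine ⟨?_, ?_, ?_⟩
    · rw [← hmp.integrable_comp_emb e.symm.measurableEmbedding]
      exact hprod.congr (Filter.Eventually.of_forall fun p => (he p).symm)
    · rw [← hmp.integral_comp e.symm.measurableEmbedding]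
      simp only [he]
      rw [Measure.volume_eq_prod, integral_prod _ hprod]
      rw [Measure.volume_eq_prod, integral_prod _ h1] at h2
      have h4 : ∫ q : Fin 2 → ℝ, ∫ r : Fin J → Fin 2 → ℝ, quadPullback (F q) r =
          ∫ q : Fin 2 → ℝ, (J.factorial : ℂ) * ∫ c : Fin (2 * J) → ℝ, F q (toMonic c) := by
        refine integral_congr_ae ?_
        filter_upwards [hslice] with q hq
        exact (ih (F q) (hFcont q) hq).2.1
      rw [h4, integral_const_mul, h2, Nat.factorial_succ]
      push_cast
      ring
    · rw [← hmp.integral_comp e.symm.measurableEmbedding]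
      simp only [he]
      rw [Measure.volume_eq_prod, integral_prod _ hprod.norm]
      rw [Measure.volume_eq_prod, integral_prod _ h1.norm] at h3
      calc ∫ q : Fin 2 → ℝ, ∫ r : Fin J → Fin 2 → ℝ, ‖quadPullback (F q) r‖ ≤
          ∫ q : Fin 2 → ℝ, K * ∫ c : Fin (2 * J) → ℝ, ‖F q (toMonic c)‖ := by
            refine integral_mono_ae hnormint (h1.norm.integral_prod_left.const_mul K) ?_
            filter_upwards [hslice] with q hq
            exact (ih (F q) (hFcont q) hq).2.2
        _ = K * ∫ q : Fin 2 → ℝ, ∫ c : Fin (2 * J) → ℝ, ‖F q (toMonic c)‖ :=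
            integral_const_mul _ _
        _ ≤ _ := by
            rw [mul_assoc]
            exact mul_le_mul_of_nonneg_left h3 hK0

end QuadraticFactorization

/-! ### Determinants with paired columns. -/

section PairedDeterminants

open Equiv

variable {R : Type*} [CommRing R]

theorem Fintype.sum_perm_fin_two (f : Perm (Fin 2) → R) :
    ∑ π, f π = f 1 + f (swap 0 1) := by
  rw [← Equiv.sum_comp (Equiv.Perm.decomposeFin.symm), Fintype.sum_prod_type]
  simp [Fin.sum_univ_two]
  rfl

/-- Antisymmetrizing a determinant in pairs of columns. -/
theorem two_pow_mul_sum_perm {J : ℕ} (u : Fin J → Fin 2 → Fin J × Fin 2 → R) :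
    2 ^ J * ∑ σ : Perm (Fin J × Fin 2), ((Perm.sign σ : ℤ) : R) *
        ∏ k, (u k 0 (σ (k, 0)) * u k 1 (σ (k, 1))) =
      ∑ σ : Perm (Fin J × Fin 2), ((Perm.sign σ : ℤ) : R) *
        ∏ k, (u k 0 (σ (k, 0)) * u k 1 (σ (k, 1)) - u k 0 (σ (k, 1)) * u k 1 (σ (k, 0))) := by
  have h1 : ∀ σ : Perm (Fin J × Fin 2),
      ∏ k, (u k 0 (σ (k, 0)) * u k 1 (σ (k, 1)) - u k 0 (σ (k, 1)) * u k 1 (σ (k, 0))) =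
      ∑ π : Fin J → Perm (Fin 2), ∏ k, (((Perm.sign (π k) : ℤ) : R) *
        (u k 0 (σ (k, π k 0)) * u k 1 (σ (k, π k 1)))) := by
    intro σ
    rw [← Fintype.prod_sum fun k (π : Perm (Fin 2)) => ((Perm.sign π : ℤ) : R) *
        (u k 0 (σ (k, π 0)) * u k 1 (σ (k, π 1)))]
    refine Finset.prod_congr rfl fun k _ => ?_
    rw [Fintype.sum_perm_fin_two]
    simp
    ring
  simp_rw [h1, Finset.mul_sum]
  rw [Finset.sum_comm]
  -- Composing `σ` with the blockwise permutation `π` absorbs the signs of `π`, so each of the `2^J`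
  -- choices of `π` gives the same sum.
  have h2 : ∀ π : Fin J → Perm (Fin 2),
      ∑ σ : Perm (Fin J × Fin 2), ((Perm.sign σ : ℤ) : R) *
        ∏ k, (((Perm.sign (π k) : ℤ) : R) *
          (u k 0 (σ (k, π k 0)) * u k 1 (σ (k, π k 1)))) =
      ∑ σ : Perm (Fin J × Fin 2), ((Perm.sign σ : ℤ) : R) *
        ∏ k, (u k 0 (σ (k, 0)) * u k 1 (σ (k, 1))) := by
    intro π
    rw [← Equiv.sum_comp (Equiv.mulRight (Equiv.prodCongrRight π)) (fun σ => ((Perm.sign σ : ℤ) : R) *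
        ∏ k, (u k 0 (σ (k, 0)) * u k 1 (σ (k, 1))))]
    refine Finset.sum_congr rfl fun σ _ => ?_
    rw [Finset.prod_mul_distrib, ← mul_assoc]
    congr 1
    rw [Equiv.coe_mulRight, Perm.sign_mul, Perm.sign_prodCongrRight]
    push_cast
    rfl
  rw [Finset.sum_congr rfl fun π _ => h2 π]
  simp [Fintype.card_perm, Finset.mul_sum]

/-- The signed sum over permutations of products of a block diagonal skew-symmetric form. -/
theorem sum_perm_prod_skew_block {J : ℕ} (B : Fin J × Fin 2 → Fin J × Fin 2 → R) (M : Fin J → R)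
    (h01 : ∀ i j, B (i, 0) (j, 1) = if i = j then M j else 0)
    (h10 : ∀ i j, B (j, 1) (i, 0) = -if i = j then M j else 0)
    (h00 : ∀ i j, B (i, 0) (j, 0) = 0) (h11 : ∀ i j, B (i, 1) (j, 1) = 0) :
    ∑ σ : Perm (Fin J × Fin 2), ((Perm.sign σ : ℤ) : R) * ∏ k, B (σ (k, 0)) (σ (k, 1)) =
      2 ^ J * J.factorial * ∏ j, M j := by
  classical
  -- The form is the sum of `M j` times the elementary alternating forms of the blocks. Expanding
  -- the product chooses a block `φ k` for every `k`.
  have hB : ∀ a b : Fin J × Fin 2, B a b = ∑ j, M j *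
      ((if a = (j, 0) then 1 else 0) * (if b = (j, 1) then 1 else 0) -
        (if b = (j, 0) then 1 else 0) * (if a = (j, 1) then 1 else 0)) := by
    rintro ⟨i, r⟩ ⟨i', r'⟩
    fin_cases r <;> fin_cases r'
    · simp [h00]
    · simp [h01]
    · simp [h10]
    · simp [h11]
  simp_rw [hB, Fintype.prod_sum, Finset.mul_sum]
  rw [Finset.sum_comm]
  simp_rw [Finset.prod_mul_distrib, mul_left_comm, ← Finset.mul_sum]
  -- For a fixed choice `φ`, undoing the antisymmetrization leaves a determinant of standard basis
  -- columns; it vanishes if a block is repeated.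
  have h1 : ∀ φ : Fin J → Fin J, ∑ σ : Perm (Fin J × Fin 2), ((Perm.sign σ : ℤ) : R) *
      ∏ k, ((if σ (k, 0) = (φ k, 0) then 1 else 0) * (if σ (k, 1) = (φ k, 1) then 1 else 0) -
        (if σ (k, 1) = (φ k, 0) then 1 else 0) * (if σ (k, 0) = (φ k, 1) then 1 else 0)) =
      2 ^ J * Matrix.det (Matrix.of fun a b : Fin J × Fin 2 =>
        if a = (φ b.1, b.2) then (1 : R) else 0) := by
    intro φ
    rw [Matrix.det_apply']
    rw [← two_pow_mul_sum_perm fun k r a => if a = (φ k, r) then (1 : R) else 0]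
    simp [Fintype.prod_prod_type, Fin.prod_univ_two]
  simp_rw [h1]
  have h2 : ∀ φ : Fin J → Fin J, ¬ Function.Injective φ →
      Matrix.det (Matrix.of fun a b : Fin J × Fin 2 => if a = (φ b.1, b.2) then (1 : R) else 0) =
        0 := by
    intro φ hφ
    simp only [Function.Injective, not_forall] at hφ
    obtain ⟨k, l, hkl, hne⟩ := hφ
    refine Matrix.det_zero_of_column_eq (i := (k, 0)) (j := (l, 0)) (by simp [hne]) fun a => ?_
    simp [hkl]
  have h3 : ∀ ρ : Perm (Fin J),
      Matrix.det (Matrix.of fun a b : Fin J × Fin 2 => if a = (ρ b.1, b.2) then (1 : R) else 0) =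
        1 := by
    intro ρ
    have h4 : (Matrix.of fun a b : Fin J × Fin 2 => if a = (ρ b.1, b.2) then (1 : R) else 0) =
        (1 : Matrix (Fin J × Fin 2) (Fin J × Fin 2) R).submatrix id
          (Equiv.prodCongrLeft fun _ : Fin 2 => ρ) := by
      ext a b
      simp only [Matrix.of_apply, Matrix.submatrix_apply, Matrix.one_apply, id_eq]
      rfl
    -- A permutation of blocks acts identically on the two members of each pair, so its sign appears
    -- squared.
    rw [h4, Matrix.det_permute', Matrix.det_one, mul_one, Perm.sign_prodCongrLeft]
    simp
  have h5 : ∑ ρ : Perm (Fin J), (2 : R) ^ J * ∏ j, M j =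
      ∑ φ : Fin J → Fin J, (∏ k, M (φ k)) * (2 ^ J * Matrix.det (Matrix.of fun a b : Fin J × Fin 2 =>
        if a = (φ b.1, b.2) then (1 : R) else 0)) := by
    refine Finset.sum_of_injOn (fun ρ : Perm (Fin J) => (ρ : Fin J → Fin J))
      (fun _ _ _ _ h => DFunLike.coe_injective h) (fun _ _ => Finset.mem_coe.2 (Finset.mem_univ _))
      ?_ ?_
    · intro φ _ hφ
      rw [h2 φ, mul_zero, mul_zero]
      intro hinj
      exact hφ ⟨Equiv.ofBijective φ (Finite.injective_iff_bijective.1 hinj),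
        Finset.mem_coe.2 (Finset.mem_univ _), rfl⟩
    · intro ρ _
      rw [h3 ρ, Equiv.prod_comp ρ M]
      ring
  rw [← h5]
  simp [Fintype.card_perm]
  ring

end PairedDeterminants

/-! ### The Vandermonde determinant grouped in pairs. -/

section PairedVandermonde

/-- The bijection `(k, r) ↦ 2 * k + r`. -/
def pairIndex (J : ℕ) : Fin J × Fin 2 ≃ Fin (2 * J) :=
  finProdFinEquiv.trans (finCongr (mul_comm J 2))

theorem pairIndex_val {J : ℕ} (a : Fin J × Fin 2) : (pairIndex J a : ℕ) = a.2 + 2 * a.1 := rfl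

theorem pairIndex_fst {J : ℕ} (k : Fin J) : pairIndex J (k, 0) = pairFst k :=
  Fin.ext (by simp [pairIndex_val, pairFst])

theorem pairIndex_snd {J : ℕ} (k : Fin J) : pairIndex J (k, 1) = pairSnd k :=
  Fin.ext (by simp [pairIndex_val, pairSnd, add_comm])

theorem det_eval_pairs {J : ℕ} {Q : Fin (2 * J) → ℂ[X]} (hQ : IsCompleteMonicFamily Q)
    (z : Fin J → Fin 2 → ℂ) :
    (Matrix.of fun a b : Fin J × Fin 2 => (Q (pairIndex J a)).eval (z b.1 b.2)).det =
      (∏ k, (z k 1 - z k 0)) * ∏ i, ∏ j ∈ Finset.Ioi i,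
        (((z i 0 - z j 0) * (z i 0 - z j 1)) * ((z i 1 - z j 0) * (z i 1 - z j 1))) := by
  classical
  set v : Fin (2 * J) → ℂ := fun l => z ((pairIndex J).symm l).1 ((pairIndex J).symm l).2 with hv
  have h1 := Matrix.det_eval_matrixOfPolynomials_eq_det_vandermonde v Q (fun i => (hQ i).2)
    (fun i => (hQ i).1)
  have h2 : (Matrix.of fun a b : Fin J × Fin 2 => (Q (pairIndex J a)).eval (z b.1 b.2)) =
      ((Matrix.of fun i j => (Q j).eval (v i)).transpose).submatrix (pairIndex J) (pairIndex J) := by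
    ext a b
    simp [hv]
  rw [h2, Matrix.det_submatrix_equiv_self, Matrix.det_transpose, ← h1, Matrix.det_vandermonde]
  have h3 : ∀ (n : ℕ) (F : Fin n → Fin n → ℂ),
      ∏ i, ∏ j ∈ Finset.Ioi i, F i j = ∏ i, ∏ j, if i < j then F i j else 1 := by
    intro n F
    refine Finset.prod_congr rfl fun i _ => ?_
    rw [← Finset.prod_filter]
    congr 1
    ext j; simp
  rw [h3, h3, ← (pairIndex J).prod_comp]
  have h4 : ∀ a, (∏ j, if pairIndex J a < j then v j - v (pairIndex J a) else 1) =
      ∏ b, if pairIndex J a < pairIndex J b then z b.1 b.2 - z a.1 a.2 else 1 := by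
    intro a
    rw [← (pairIndex J).prod_comp]
    simp [hv]
  simp_rw [h4, Fintype.prod_prod_type, Fin.prod_univ_two, ← Finset.prod_mul_distrib]
  -- The factor inside a pair becomes the diagonal term `j = i`. Between two distinct pairs there
  -- are four differences, so reversing all of them costs no sign.
  have h5 : ∀ i : Fin J, z i 1 - z i 0 = ∏ j, if i = j then z i 1 - z i 0 else 1 := by
    intro i
    rw [Finset.prod_ite_eq, if_pos (Finset.mem_univ _)]
  refine Finset.prod_congr rfl fun i _ => ?_
  rw [h5 i, ← Finset.prod_mul_distrib]
  refine Finset.prod_congr rfl fun j _ => ?_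
  simp only [Fin.lt_def, pairIndex_val, Fin.val_zero, Fin.val_one]
  rcases lt_trichotomy (i : ℕ) (j : ℕ) with h | h | h
  · rw [if_pos (by omega), if_pos (by omega), if_pos (by omega), if_pos (by omega),
      if_neg (by rintro rfl; omega), if_pos h]
    ring
  · have hij : i = j := Fin.ext h
    subst hij
    simp
  · rw [if_neg (by omega), if_neg (by omega), if_neg (by omega), if_neg (by omega),
      if_neg (by rintro rfl; omega), if_neg (by omega)]
    ring

/-- The antisymmetrization of `P(x)Q(y)` divided by `y - x`, at the roots `x`, `y` of a quadratic
polynomial. -/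
noncomputable def pairKernel (P Q : ℂ[X]) (q : Fin 2 → ℝ) : ℂ :=
  (P.eval (rootFst q) * Q.eval (rootSnd q) - P.eval (rootSnd q) * Q.eval (rootFst q)) /
    (rootSnd q - rootFst q)

/-- Multiplied by the differences within the pairs, the product of resultants is the determinant of
the values of the `Q` at all roots. Antisymmetrize it in pairs and divide the differences back out,
one for each kernel. -/
theorem two_pow_mul_resultantProd {J : ℕ} {Q : Fin (2 * J) → ℂ[X]} (hQ : IsCompleteMonicFamily Q)
    {q : Fin J → Fin 2 → ℝ} (hq : ∀ k, quadDisc (q k) ≠ 0) :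
    2 ^ J * ((resultantProd q : ℝ) : ℂ) =
      ∑ σ : Equiv.Perm (Fin J × Fin 2), ((Equiv.Perm.sign σ : ℤ) : ℂ) *
        ∏ k, pairKernel (Q (pairIndex J (σ (k, 0)))) (Q (pairIndex J (σ (k, 1)))) (q k) := by
  set z : Fin J → Fin 2 → ℂ := fun k => ![rootFst (q k), rootSnd (q k)] with hz
  have hne : ∏ k, (z k 1 - z k 0) ≠ 0 :=
    Finset.prod_ne_zero_iff.2 fun k _ => rootSnd_sub_rootFst_ne_zero (hq k)
  have hres : ((resultantProd q : ℝ) : ℂ) = ∏ i, ∏ j ∈ Finset.Ioi i,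
      (((z i 0 - z j 0) * (z i 0 - z j 1)) * ((z i 1 - z j 0) * (z i 1 - z j 1))) := by
    rw [resultantProd]
    push_cast
    refine Finset.prod_congr rfl fun i _ => Finset.prod_congr rfl fun j _ => ?_
    rw [resultant_toMonic_two, map_toMonic_two]
    simp [hz]
  have hdet := det_eval_pairs hQ z
  rw [← hres, Matrix.det_apply'] at hdet
  have h := two_pow_mul_sum_perm fun k r a => (Q (pairIndex J a)).eval (z k r)
  simp only [Matrix.of_apply, Fintype.prod_prod_type, Fin.prod_univ_two] at hdet
  rw [hdet] at h
  refine mul_left_cancel₀ hne ?_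
  rw [mul_left_comm, h, Finset.mul_sum]
  refine Finset.sum_congr rfl fun σ _ => ?_
  rw [mul_left_comm, ← Finset.prod_mul_distrib]
  congr 1
  refine Finset.prod_congr rfl fun k _ => ?_
  have := rootSnd_sub_rootFst_ne_zero (hq k)
  simp only [hz, pairKernel, Matrix.cons_val_zero, Matrix.cons_val_one]
  field_simp

end PairedVandermonde

/-! ### Growth bounds and integrability. -/

section DistanceFunction

variable {Φ : ℂ[X] → ℝ}

namespace IsMultiplicativeDistanceFunction

theorem pos (hΦ : IsMultiplicativeDistanceFunction Φ) {f : ℂ[X]} (hf : f ≠ 0) : 0 < Φ f :=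
  lt_of_le_of_ne (hΦ.nonneg f) fun h => hf ((hΦ.eq_zero_iff f).1 h.symm)

theorem map_one (hΦ : IsMultiplicativeDistanceFunction Φ) : Φ 1 = 1 := by
  have h := hΦ.map_mul 1 1
  rw [mul_one] at h
  exact (mul_eq_left₀ (hΦ.pos one_ne_zero).ne').1 h.symm

/-- A positive minimum on the compact unit sphere, extended by homogeneity. -/
theorem exists_pos_mul_norm_le (hΦ : IsMultiplicativeDistanceFunction Φ) (n : ℕ) :
    ∃ c : ℝ, 0 < c ∧ ∀ v : Fin n → ℂ, c * ‖v‖ ≤ Φ (∑ i : Fin n, C (v i) * X ^ (i : ℕ)) := by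
  have hzero : ∀ v : Fin n → ℂ, ∑ i : Fin n, C (v i) * X ^ (i : ℕ) = 0 → v = 0 := by
    intro v hv
    funext i
    have h := congrArg (fun p : ℂ[X] => p.coeff i) hv
    simp only [finsetSum_coeff, coeff_C_mul, coeff_X_pow, coeff_zero] at h
    rw [Finset.sum_eq_single i] at h
    · simpa using h
    · intro j _ hj
      simp [Fin.val_eq_val, hj.symm]
    · simp
  obtain ⟨c, hc, hle⟩ := (isCompact_sphere (0 : Fin n → ℂ) 1).exists_forall_le'
    (hΦ.continuous_coeff n).continuousOn (a := 0) (fun v hv => hΦ.pos fun h => by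
      rw [hzero v h] at hv
      simp at hv)
  refine ⟨c, hc, fun v => ?_⟩
  rcases eq_or_ne v 0 with rfl | hv
  · simpa using hΦ.nonneg _
  · have hn : 0 < ‖v‖ := norm_pos_iff.2 hv
    have h1 := hle ((‖v‖ : ℂ)⁻¹ • v) (by simp [norm_smul, hn.ne'])
    have h2 : ∑ i : Fin n, C (((‖v‖ : ℂ)⁻¹ • v) i) * X ^ (i : ℕ) =
        C (‖v‖ : ℂ)⁻¹ * ∑ i : Fin n, C (v i) * X ^ (i : ℕ) := by
      simp [Finset.mul_sum, mul_assoc]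
    rw [h2, hΦ.map_C_mul, norm_inv, Complex.norm_real, norm_norm] at h1
    rwa [← le_div_iff₀ hn, div_eq_inv_mul]

theorem exists_pos_mul_one_add_norm_le (hΦ : IsMultiplicativeDistanceFunction Φ) (n : ℕ) :
    ∃ c : ℝ, 0 < c ∧ ∀ v : Fin n → ℂ,
      c * (1 + ‖v‖) ≤ Φ (X ^ n + ∑ i : Fin n, C (v i) * X ^ (i : ℕ)) := by
  obtain ⟨c, hc, h⟩ := hΦ.exists_pos_mul_norm_le (n + 1)
  -- With the leading coefficient `1` appended, the sup norm is at least `max 1 ‖v‖ ≥ (1 + ‖v‖) /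
  -- 2`.
  refine ⟨c / 2, by positivity, fun v => ?_⟩
  set w : Fin (n + 1) → ℂ := Fin.snoc v 1 with hw
  have h1 := h w
  rw [Fin.sum_univ_castSucc] at h1
  simp only [hw, Fin.snoc_castSucc, Fin.snoc_last, Fin.val_castSucc, Fin.val_last, C_1,
    one_mul] at h1
  rw [add_comm (∑ i : Fin n, _)] at h1
  refine le_trans ?_ h1
  rw [← hw]
  have h2 : (1 : ℝ) ≤ ‖w‖ := by
    have := norm_le_pi_norm w (Fin.last n)
    simpa [hw] using this
  have h3 : ‖v‖ ≤ ‖w‖ := by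
    refine (pi_norm_le_iff_of_nonneg (norm_nonneg _)).2 fun i => ?_
    have := norm_le_pi_norm w i.castSucc
    simpa [hw] using this
  nlinarith

theorem continuous_monic (hΦ : IsMultiplicativeDistanceFunction Φ) (n : ℕ) :
    Continuous fun v : Fin n → ℂ => Φ (X ^ n + ∑ i : Fin n, C (v i) * X ^ (i : ℕ)) := by
  have h := (hΦ.continuous_coeff (n + 1)).comp
    (show Continuous fun v : Fin n → ℂ => (Fin.snoc v 1 : Fin (n + 1) → ℂ) by
      refine continuous_pi fun i => ?_
      refine Fin.lastCases ?_ (fun j => ?_) i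
      · simp only [Fin.snoc_last]; exact continuous_const
      · simp only [Fin.snoc_castSucc]; exact continuous_apply j)
  refine h.congr fun v => ?_
  rw [Function.comp_apply, Fin.sum_univ_castSucc]
  simp only [Fin.snoc_castSucc, Fin.snoc_last, Fin.val_castSucc, Fin.val_last, C_1, one_mul]
  rw [add_comm]

theorem rootFunction_eq (Φ : ℂ[X] → ℝ) (γ : ℂ) : rootFunction Φ γ =
    Φ (X ^ 1 + ∑ i : Fin 1, C ((fun _ : Fin 1 => -γ) i) * X ^ (i : ℕ)) := by
  rw [rootFunction]; simp [sub_eq_add_neg]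

theorem rootFunction_pos (hΦ : IsMultiplicativeDistanceFunction Φ) (γ : ℂ) :
    0 < rootFunction Φ γ := hΦ.pos (X_sub_C_ne_zero γ)

theorem continuous_rootFunction (hΦ : IsMultiplicativeDistanceFunction Φ) :
    Continuous (rootFunction Φ) := by
  refine ((hΦ.continuous_monic 1).comp
    (show Continuous fun γ : ℂ => fun _ : Fin 1 => -γ by fun_prop)).congr fun γ => ?_
  exact (rootFunction_eq Φ γ).symm

theorem exists_pos_mul_one_add_norm_le_rootFunction (hΦ : IsMultiplicativeDistanceFunction Φ) :
    ∃ c : ℝ, 0 < c ∧ ∀ γ : ℂ, c * (1 + ‖γ‖) ≤ rootFunction Φ γ := by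
  obtain ⟨c, hc, h⟩ := hΦ.exists_pos_mul_one_add_norm_le 1
  refine ⟨c, hc, fun γ => ?_⟩
  have := h fun _ => -γ
  rw [← rootFunction_eq Φ γ] at this
  simpa [Pi.norm_def] using this

end IsMultiplicativeDistanceFunction

/-- The weight `Φ(p)^(-s)` of a real polynomial. -/
noncomputable def polyWeight (Φ : ℂ[X] → ℝ) (s : ℂ) (p : ℝ[X]) : ℂ :=
  ((Φ (p.map (algebraMap ℝ ℂ)) : ℝ) : ℂ) ^ (-s)

/-- The weight `φ(γ)^(-s)` of a root. -/
noncomputable def rootWeight (Φ : ℂ[X] → ℝ) (s : ℂ) (γ : ℂ) : ℂ :=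
  ((rootFunction Φ γ : ℝ) : ℂ) ^ (-s)

theorem map_toMonic {n : ℕ} (c : Fin n → ℝ) : (toMonic c).map (algebraMap ℝ ℂ) =
    X ^ n + ∑ i : Fin n, C ((fun i => (c i : ℂ)) i) * X ^ (i : ℕ) := by
  simp [toMonic, polyOfCoeffs, Polynomial.map_sum]

theorem norm_cpow_neg_le {a c t : ℝ} {s : ℂ} (hc : 0 < c) (ht : 0 ≤ t) (hs : 0 ≤ s.re)
    (h : c * (1 + t) ≤ a) : ‖(a : ℂ) ^ (-s)‖ ≤ c ^ (-s.re) * (1 + t) ^ (-s.re) := by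
  have h1 : 0 < c * (1 + t) := by positivity
  rw [Complex.norm_cpow_eq_rpow_re_of_pos (h1.trans_le h), Complex.neg_re,
    ← Real.mul_rpow hc.le (by positivity)]
  exact Real.rpow_le_rpow_of_nonpos h1 h (by linarith)

theorem continuous_ofReal_cpow_neg {Y : Type*} [TopologicalSpace Y] {a : Y → ℝ} (ha : Continuous a)
    (hpos : ∀ y, 0 < a y) (s : ℂ) : Continuous fun y => ((a y : ℝ) : ℂ) ^ (-s) := by
  refine Continuous.cpow (Complex.continuous_ofReal.comp ha) continuous_const fun y => ?_
  exact Complex.ofReal_mem_slitPlane.2 (hpos y)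

theorem continuous_polyWeight_toMonic (hΦ : IsMultiplicativeDistanceFunction Φ) (s : ℂ) (n : ℕ) :
    Continuous fun c : Fin n → ℝ => polyWeight Φ s (toMonic c) := by
  refine continuous_ofReal_cpow_neg ?_ (fun c => hΦ.pos
    ((toMonic_monic c).map (algebraMap ℝ ℂ)).ne_zero) s
  simp only [map_toMonic]
  exact (hΦ.continuous_monic n).comp
    (show Continuous fun c : Fin n → ℝ => fun i => (c i : ℂ) by fun_prop)

theorem integrable_polyWeight_toMonic (hΦ : IsMultiplicativeDistanceFunction Φ) {s : ℂ} {n : ℕ}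
    (hs : (n : ℝ) < s.re) : Integrable fun c : Fin n → ℝ => polyWeight Φ s (toMonic c) := by
  obtain ⟨c, hc, h⟩ := hΦ.exists_pos_mul_one_add_norm_le n
  have h1 : Integrable fun v : Fin n → ℝ => (1 + ‖v‖) ^ (-s.re) :=
    integrable_one_add_norm (by simpa using hs)
  refine Integrable.mono' (h1.const_mul (c ^ (-s.re)))
    (continuous_polyWeight_toMonic hΦ s n).aestronglyMeasurable
    (Filter.Eventually.of_forall fun v => ?_)
  refine norm_cpow_neg_le hc (norm_nonneg _) (le_trans (by positivity) hs.le) ?_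
  have h2 := h fun i => (v i : ℂ)
  rw [← map_toMonic] at h2
  have h3 : ‖fun i => (v i : ℂ)‖ = ‖v‖ := by simp [Pi.norm_def, nnnorm]
  rwa [h3] at h2

theorem continuous_rootWeight (hΦ : IsMultiplicativeDistanceFunction Φ) (s : ℂ) :
    Continuous (rootWeight Φ s) :=
  continuous_ofReal_cpow_neg hΦ.continuous_rootFunction hΦ.rootFunction_pos s

theorem exists_norm_eval_le (P : ℂ[X]) : ∃ C : ℝ, 0 ≤ C ∧ ∀ z : ℂ,
    ‖P.eval z‖ ≤ C * (1 + ‖z‖) ^ (P.natDegree : ℝ) := by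
  refine ⟨∑ i ∈ Finset.range (P.natDegree + 1), ‖P.coeff i‖,
    Finset.sum_nonneg fun _ _ => norm_nonneg _, fun z => ?_⟩
  rw [eval_eq_sum_range, Finset.sum_mul]
  refine (norm_sum_le _ _).trans (Finset.sum_le_sum fun i hi => ?_)
  rw [norm_mul, norm_pow, Real.rpow_natCast]
  refine mul_le_mul_of_nonneg_left ?_ (norm_nonneg _)
  calc ‖z‖ ^ i ≤ (1 + ‖z‖) ^ i := by gcongr; linarith
    _ ≤ (1 + ‖z‖) ^ P.natDegree :=
      pow_le_pow_right₀ (by linarith [norm_nonneg z]) (Nat.lt_succ_iff.1 (Finset.mem_range.1 hi))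

theorem exists_norm_rootWeight_mul_eval_le (hΦ : IsMultiplicativeDistanceFunction Φ) {s : ℂ}
    (hs : 0 ≤ s.re) (P : ℂ[X]) : ∃ C : ℝ, 0 ≤ C ∧ ∀ z : ℂ,
      ‖rootWeight Φ s z * P.eval z‖ ≤ C * (1 + ‖z‖) ^ (-(s.re - P.natDegree)) := by
  obtain ⟨c, hc, h⟩ := hΦ.exists_pos_mul_one_add_norm_le_rootFunction
  obtain ⟨D, hD, hP⟩ := exists_norm_eval_le P
  refine ⟨c ^ (-s.re) * D, by positivity, fun z => ?_⟩
  have hz : 0 < 1 + ‖z‖ := by positivity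
  rw [norm_mul, neg_sub, sub_eq_neg_add, Real.rpow_add hz]
  calc _ ≤ (c ^ (-s.re) * (1 + ‖z‖) ^ (-s.re)) * (D * (1 + ‖z‖) ^ (P.natDegree : ℝ)) :=
        mul_le_mul (norm_cpow_neg_le hc (norm_nonneg _) hs (h z)) (hP z) (norm_nonneg _)
          (by positivity)
    _ = _ := by ring

theorem integrable_rootWeight_mul_eval (hΦ : IsMultiplicativeDistanceFunction Φ) {s : ℂ}
    {P : ℂ[X]} (hs : (P.natDegree : ℝ) + 1 < s.re) :
    Integrable fun x : ℝ => rootWeight Φ s x * P.eval (x : ℂ) := by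
  obtain ⟨D, hD, h⟩ := exists_norm_rootWeight_mul_eval_le hΦ
    (le_trans (by positivity) hs.le) P
  have h1 : Integrable fun x : ℝ => (1 + ‖x‖) ^ (-(s.re - P.natDegree)) :=
    integrable_one_add_norm (by simp; linarith)
  refine Integrable.mono' (h1.const_mul D) ?_ (Filter.Eventually.of_forall fun x => ?_)
  · have := continuous_rootWeight hΦ s
    exact Continuous.aestronglyMeasurable (by fun_prop)
  · simpa using h x

theorem integrable_rootWeight_mul_conj (hΦ : IsMultiplicativeDistanceFunction Φ) {s : ℂ}
    {P Q : ℂ[X]} (hP : (P.natDegree : ℝ) + 1 < s.re) (hQ : (Q.natDegree : ℝ) + 1 < s.re) :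
    Integrable fun β : ℂ => rootWeight Φ s β * rootWeight Φ s (starRingEnd ℂ β) *
      P.eval (starRingEnd ℂ β) * Q.eval β := by
  obtain ⟨D, hD, h⟩ := exists_norm_rootWeight_mul_eval_le hΦ
    (le_trans (by positivity) hP.le) P
  obtain ⟨D', hD', h'⟩ := exists_norm_rootWeight_mul_eval_le hΦ
    (le_trans (by positivity) hP.le) Q
  -- Each factor decays with exponent greater than `1`, so the product beats the real dimension `2`
  -- of the plane.
  have h1 : Integrable fun x : ℂ => (1 + ‖x‖) ^ (-((s.re - P.natDegree) + (s.re - Q.natDegree))) :=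
    integrable_one_add_norm (by rw [Complex.finrank_real_complex]; push_cast; linarith)
  refine Integrable.mono' (h1.const_mul (D * D')) ?_ (Filter.Eventually.of_forall fun x => ?_)
  · have := continuous_rootWeight hΦ s
    have := Complex.continuous_conj
    exact Continuous.aestronglyMeasurable (by fun_prop)
  · have hx : 0 < 1 + ‖x‖ := by positivity
    have e : rootWeight Φ s x * rootWeight Φ s (starRingEnd ℂ x) *
      P.eval (starRingEnd ℂ x) * Q.eval x = (rootWeight Φ s (starRingEnd ℂ x) *
      P.eval (starRingEnd ℂ x)) * (rootWeight Φ s x * Q.eval x) := by ring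
    rw [e, norm_mul, neg_add, Real.rpow_add hx]
    have h2 := h (starRingEnd ℂ x)
    rw [Complex.norm_conj] at h2
    calc _ ≤ (D * (1 + ‖x‖) ^ (-(s.re - P.natDegree))) *
          (D' * (1 + ‖x‖) ^ (-(s.re - Q.natDegree))) :=
          mul_le_mul h2 (h' x) (norm_nonneg _) (by positivity)
      _ = _ := by ring

theorem polyWeight_prod (hΦ : IsMultiplicativeDistanceFunction Φ) (s : ℂ) {ι : Type*}
    (t : Finset ι) (p : ι → ℝ[X]) :
    polyWeight Φ s (∏ i ∈ t, p i) = ∏ i ∈ t, polyWeight Φ s (p i) := by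
  classical
  induction t using Finset.induction_on with
  | empty => simp [polyWeight, hΦ.map_one]
  | insert a t ha ih =>
    rw [Finset.prod_insert ha, Finset.prod_insert ha, ← ih, polyWeight, Polynomial.map_mul,
      hΦ.map_mul, Complex.ofReal_mul,
      Complex.mul_cpow_ofReal_nonneg (hΦ.nonneg _) (hΦ.nonneg _)]
    rfl

theorem polyWeight_toMonic_two (hΦ : IsMultiplicativeDistanceFunction Φ) (s : ℂ)
    (q : Fin 2 → ℝ) :
    polyWeight Φ s (toMonic q) = rootWeight Φ s (rootFst q) * rootWeight Φ s (rootSnd q) := by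
  rw [polyWeight, map_toMonic_two, hΦ.map_mul, Complex.ofReal_mul,
    Complex.mul_cpow_ofReal_nonneg (hΦ.nonneg _) (hΦ.nonneg _)]
  rfl

end DistanceFunction

/-! ### The skew form as an integral over quadratics. -/

section SkewFormIntegral

/-- Folds a sign-weighted integral onto the half where `ε > 0`. It serves the swap of two real
variables and complex conjugation alike. -/
theorem setIntegral_sub_comp_involution {Y : Type*} [MeasurableSpace Y] {μ : Measure Y}
    (τ : Y ≃ᵐ Y) (hτ : MeasurePreserving τ μ μ) (hinv : ∀ y, τ (τ y) = y) {ε : Y → ℝ}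
    (hε : Measurable ε) (hετ : ∀ y, ε (τ y) = -ε y) {H : Y → ℂ} (hH : Integrable H μ) :
    IntegrableOn (fun y => H y - H (τ y)) {y | 0 < ε y} μ ∧
      ∫ y in {y | 0 < ε y}, (H y - H (τ y)) ∂μ = ∫ y, H y * ((Real.sign (ε y) : ℝ) : ℂ) ∂μ := by
  have hA : MeasurableSet {y | 0 < ε y} := hε measurableSet_Ioi
  have hHτ : Integrable (fun y => H (τ y)) μ := (hτ.integrable_comp_emb τ.measurableEmbedding).2 hH
  refine ⟨(hH.sub hHτ).integrableOn, ?_⟩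
  have h1 : ∀ y, H y * ((Real.sign (ε y) : ℝ) : ℂ) = {y | 0 < ε y}.indicator H y -
      {y | 0 < ε y}.indicator (fun y => H (τ y)) (τ y) := by
    intro y
    simp only [Set.indicator_apply, Set.mem_ofPred_eq, hετ, hinv]
    rcases lt_trichotomy (ε y) 0 with h | h | h
    · rw [Real.sign_of_neg h, if_neg h.not_gt, if_pos (by linarith)]; simp
    · simp [h]
    · rw [Real.sign_of_pos h, if_pos h, if_neg (by linarith)]; simp
  simp_rw [h1]
  have hi1 : Integrable ({y | 0 < ε y}.indicator H) μ := hH.indicator hA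
  have hi2 : Integrable ({y | 0 < ε y}.indicator fun y => H (τ y)) μ := hHτ.indicator hA
  have hi3 : Integrable (fun y => {y | 0 < ε y}.indicator (fun y => H (τ y)) (τ y)) μ :=
    (hτ.integrable_comp_emb τ.measurableEmbedding).2 hi2
  rw [integral_sub hi1 hi3, integral_sub hH.integrableOn hHτ.integrableOn,
    hτ.integral_comp τ.measurableEmbedding, integral_indicator hA, integral_indicator hA]

/-- The derivative of a map of the plane with the given partial derivatives. -/
noncomputable def planeDeriv (A : Matrix (Fin 2) (Fin 2) ℝ) :
    (Fin 2 → ℝ) →L[ℝ] (Fin 2 → ℝ) :=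
  LinearMap.toContinuousLinearMap (Matrix.toLin' A)

theorem det_planeDeriv (A : Matrix (Fin 2) (Fin 2) ℝ) :
    (planeDeriv A).det = A 0 0 * A 1 1 - A 0 1 * A 1 0 := by
  rw [planeDeriv, ContinuousLinearMap.det, LinearMap.coe_toContinuousLinearMap,
    LinearMap.det_toLin', Matrix.det_fin_two]

theorem hasFDerivAt_coord (i : Fin 2) (v : Fin 2 → ℝ) :
    HasFDerivAt (fun w : Fin 2 → ℝ => w i) (ContinuousLinearMap.proj (R := ℝ) i) v :=
  (ContinuousLinearMap.proj (R := ℝ) (φ := fun _ : Fin 2 => ℝ) i).hasFDerivAt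

theorem hasFDerivAt_quadOfReal (v : Fin 2 → ℝ) :
    HasFDerivAt (fun w : Fin 2 → ℝ => quadOfReal (w 0, w 1))
      (planeDeriv !![v 1, v 0; -1, -1]) v := by
  refine hasFDerivAt_pi'' fun i => ?_
  fin_cases i
  · refine ((hasFDerivAt_coord 0 v).mul (hasFDerivAt_coord 1 v)).congr_fderiv ?_
    ext1 w
    simp [planeDeriv, Matrix.vecHead, Matrix.vecTail]
    ring
  · refine ((hasFDerivAt_coord 0 v).add (hasFDerivAt_coord 1 v)).neg.congr_fderiv ?_
    ext1 w
    simp [planeDeriv, Matrix.vecHead, Matrix.vecTail]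
    ring

theorem hasFDerivAt_quadOfComplex (v : Fin 2 → ℝ) :
    HasFDerivAt (fun w : Fin 2 → ℝ => quadOfComplex ⟨w 0, w 1⟩)
      (planeDeriv !![2 * v 0, 2 * v 1; -2, 0]) v := by
  refine hasFDerivAt_pi'' fun i => ?_
  fin_cases i
  · refine (((hasFDerivAt_coord 0 v).pow 2).add ((hasFDerivAt_coord 1 v).pow 2)).congr_fderiv ?_
    ext1 w
    simp [planeDeriv, Matrix.vecHead, Matrix.vecTail]
  · refine ((hasFDerivAt_coord 0 v).const_mul 2).neg.congr_fderiv ?_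
    ext1 w
    simp [planeDeriv, Matrix.vecHead, Matrix.vecTail]

/-- Quadratics with a double root are the image under `quadOfReal` of the diagonal, where its
Jacobian vanishes. -/
theorem volume_quadDisc_eq_zero : volume {q : Fin 2 → ℝ | quadDisc q = 0} = 0 := by
  refine measure_mono_null ?_ (addHaar_image_eq_zero_of_det_fderivWithin_eq_zero volume
    (f := fun w : Fin 2 → ℝ => quadOfReal (w 0, w 1)) (s := {v | v 0 = v 1})
    (fun v _ => (hasFDerivAt_quadOfReal v).hasFDerivWithinAt) fun v hv => ?_)
  · intro q hq
    obtain ⟨a, ha⟩ := exists_sq_of_quadDisc_eq_zero hq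
    refine ⟨fun _ => a, rfl, toMonic_injective ?_⟩
    rw [toMonic_quadOfReal, ha]
  · rw [Set.mem_ofPred_eq] at hv
    rw [det_planeDeriv]
    simp [hv]

theorem image_quadOfReal : (fun w : Fin 2 → ℝ => quadOfReal (w 0, w 1)) '' {v | v 0 < v 1} =
    {q | 0 < quadDisc q} := by
  ext q
  constructor
  · rintro ⟨v, hv, rfl⟩
    rw [Set.mem_ofPred_eq] at hv ⊢
    rw [quadDisc_quadOfReal]
    exact pow_pos (sub_pos.2 hv) 2
  · intro hq
    obtain ⟨p, hp, rfl⟩ := exists_quadOfReal_of_quadDisc_pos hq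
    exact ⟨![p.1, p.2], by simpa using hp, by simp⟩

theorem image_quadOfComplex : (fun w : Fin 2 → ℝ => quadOfComplex ⟨w 0, w 1⟩) '' {v | 0 < v 1} =
    {q | quadDisc q < 0} := by
  ext q
  constructor
  · rintro ⟨v, hv, rfl⟩
    rw [Set.mem_ofPred_eq] at hv ⊢
    rw [quadDisc_quadOfComplex, neg_lt_zero]
    exact pow_pos (by simpa using hv) 2
  · intro hq
    obtain ⟨β, hβ, rfl⟩ := exists_quadOfComplex_of_quadDisc_neg hq
    exact ⟨![β.re, β.im], by simpa using hβ, by simp⟩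

theorem injOn_quadOfReal :
    Set.InjOn (fun w : Fin 2 → ℝ => quadOfReal (w 0, w 1)) {v | v 0 < v 1} := by
  intro v hv w hw h
  rw [Set.mem_ofPred_eq] at hv hw
  have h1 := congrArg rootFst h
  have h2 := congrArg rootSnd h
  simp only at h1 h2
  rw [rootFst_quadOfReal hv.le, rootFst_quadOfReal hw.le] at h1
  rw [rootSnd_quadOfReal hv.le, rootSnd_quadOfReal hw.le] at h2
  funext i
  fin_cases i
  · exact Complex.ofReal_injective h1
  · exact Complex.ofReal_injective h2

theorem injOn_quadOfComplex :
    Set.InjOn (fun w : Fin 2 → ℝ => quadOfComplex ⟨w 0, w 1⟩) {v | 0 < v 1} := by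
  intro v hv w hw h
  rw [Set.mem_ofPred_eq] at hv hw
  have h2 := congrArg rootSnd h
  simp only at h2
  rw [rootSnd_quadOfComplex (β := ⟨v 0, v 1⟩) hv.le,
    rootSnd_quadOfComplex (β := ⟨w 0, w 1⟩) hw.le] at h2
  funext i
  fin_cases i
  · exact congrArg Complex.re h2
  · exact congrArg Complex.im h2

variable {Φ : ℂ[X] → ℝ}

/-- In the coordinates given by the two real roots, the Jacobian `|v 0 - v 1|` cancels the
denominator of `pairKernel`. -/
theorem setIntegral_quadDisc_pos (hΦ : IsMultiplicativeDistanceFunction Φ) {s : ℂ} {P Q : ℂ[X]}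
    (hP : (P.natDegree : ℝ) + 1 < s.re) (hQ : (Q.natDegree : ℝ) + 1 < s.re) :
    IntegrableOn (fun q => polyWeight Φ s (toMonic q) * pairKernel P Q q) {q | 0 < quadDisc q} ∧
      ∫ q in {q | 0 < quadDisc q}, polyWeight Φ s (toMonic q) * pairKernel P Q q =
        realSkewForm Φ s P Q := by
  set H : ℝ × ℝ → ℂ := fun p => rootWeight Φ s p.1 * rootWeight Φ s p.2 * P.eval (p.1 : ℂ) *
    Q.eval (p.2 : ℂ) with hH
  have hHint : Integrable H := by
    refine ((integrable_rootWeight_mul_eval hΦ hP).mul_prod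
      (integrable_rootWeight_mul_eval hΦ hQ)).congr (Filter.Eventually.of_forall fun p => ?_)
    simp only [hH]
    ring
  obtain ⟨h1, h2⟩ := setIntegral_sub_comp_involution (MeasurableEquiv.prodComm (α := ℝ) (β := ℝ))
    Measure.measurePreserving_swap (fun _ => rfl)
    (show Measurable fun p : ℝ × ℝ => p.2 - p.1 by fun_prop)
    (fun p => (neg_sub p.2 p.1).symm) hHint
  have hreal : realSkewForm Φ s P Q =
      ∫ p : ℝ × ℝ, H p * ((Real.sign (p.2 - p.1) : ℝ) : ℂ) := rfl
  rw [hreal]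
  have hs : MeasurableSet {v : Fin 2 → ℝ | v 0 < v 1} :=
    measurableSet_lt (measurable_pi_apply 0) (measurable_pi_apply 1)
  have hd : ∀ v ∈ {v : Fin 2 → ℝ | v 0 < v 1}, HasFDerivWithinAt
      (fun w : Fin 2 → ℝ => quadOfReal (w 0, w 1)) (planeDeriv !![v 1, v 0; -1, -1])
      {v | v 0 < v 1} v := fun v _ => (hasFDerivAt_quadOfReal v).hasFDerivWithinAt
  have hmp := volume_preserving_finTwoArrow ℝ
  have hpre : {v : Fin 2 → ℝ | v 0 < v 1} =
      (MeasurableEquiv.finTwoArrow (α := ℝ)) ⁻¹' {p | 0 < p.2 - p.1} := by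
    ext v; simp [MeasurableEquiv.finTwoArrow]
  have hval : ∀ v ∈ {v : Fin 2 → ℝ | v 0 < v 1},
      |(planeDeriv !![v 1, v 0; -1, -1]).det| • (polyWeight Φ s (toMonic (quadOfReal (v 0, v 1))) *
        pairKernel P Q (quadOfReal (v 0, v 1))) =
      (fun p : ℝ × ℝ => H p - H (MeasurableEquiv.prodComm p)) (MeasurableEquiv.finTwoArrow v) := by
    intro v hv
    rw [Set.mem_ofPred_eq] at hv
    have e1 : (planeDeriv !![v 1, v 0; -1, -1]).det = v 0 - v 1 := by
      rw [det_planeDeriv]; simp; ring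
    have hne : (v 1 : ℂ) - v 0 ≠ 0 := by
      rw [← Complex.ofReal_sub]; exact Complex.ofReal_ne_zero.2 (sub_pos.2 hv).ne'
    have e2 : MeasurableEquiv.finTwoArrow v = (v 0, v 1) := rfl
    have e3 : (MeasurableEquiv.prodComm (v 0, v 1) : ℝ × ℝ) = (v 1, v 0) := rfl
    rw [e1, abs_of_neg (sub_neg.2 hv), polyWeight_toMonic_two hΦ, pairKernel,
      rootFst_quadOfReal (p := (v 0, v 1)) hv.le, rootSnd_quadOfReal (p := (v 0, v 1)) hv.le, e2]
    simp only [e3, hH, Complex.real_smul]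
    push_cast
    field_simp
    ring
  rw [← image_quadOfReal]
  constructor
  · rw [integrableOn_image_iff_integrableOn_abs_det_fderiv_smul volume hs hd injOn_quadOfReal,
      integrableOn_congr_fun hval hs, hpre]
    exact (hmp.integrableOn_comp_preimage MeasurableEquiv.finTwoArrow.measurableEmbedding).2 h1
  · rw [integral_image_eq_integral_abs_det_fderiv_smul volume hs hd injOn_quadOfReal,
      setIntegral_congr_fun hs hval, hpre,
      hmp.setIntegral_preimage_emb MeasurableEquiv.finTwoArrow.measurableEmbedding
        (fun p : ℝ × ℝ => H p - H (MeasurableEquiv.prodComm p))]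
    exact h2

/-- In the coordinate `β` the Jacobian is `4 Im β` and the denominator of `pairKernel` is `2i Im β`;
their quotient is the constant `-2i` of the complex form. -/
theorem setIntegral_quadDisc_neg (hΦ : IsMultiplicativeDistanceFunction Φ) {s : ℂ} {P Q : ℂ[X]}
    (hP : (P.natDegree : ℝ) + 1 < s.re) (hQ : (Q.natDegree : ℝ) + 1 < s.re) :
    IntegrableOn (fun q => polyWeight Φ s (toMonic q) * pairKernel P Q q) {q | quadDisc q < 0} ∧
      ∫ q in {q | quadDisc q < 0}, polyWeight Φ s (toMonic q) * pairKernel P Q q =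
        complexSkewForm Φ s P Q := by
  set H : ℂ → ℂ := fun β => rootWeight Φ s β * rootWeight Φ s (starRingEnd ℂ β) *
    P.eval (starRingEnd ℂ β) * Q.eval β with hH
  have hHint : Integrable H := integrable_rootWeight_mul_conj hΦ hP hQ
  obtain ⟨h1, h2⟩ := setIntegral_sub_comp_involution (Complex.conjLIE.toMeasurableEquiv)
    Complex.conjLIE.measurePreserving (fun z => Complex.conj_conj z)
    Complex.measurable_im (fun z => Complex.conj_im z) hHint
  have hcplx : complexSkewForm Φ s P Q =
      -2 * Complex.I * ∫ β : ℂ, H β * ((Real.sign β.im : ℝ) : ℂ) := rfl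
  rw [hcplx, ← h2, ← integral_const_mul]
  have h1' := Integrable.const_mul h1 (-2 * Complex.I)
  have hs : MeasurableSet {v : Fin 2 → ℝ | 0 < v 1} :=
    measurableSet_lt measurable_const (measurable_pi_apply 1)
  have hd : ∀ v ∈ {v : Fin 2 → ℝ | 0 < v 1}, HasFDerivWithinAt
      (fun w : Fin 2 → ℝ => quadOfComplex ⟨w 0, w 1⟩) (planeDeriv !![2 * v 0, 2 * v 1; -2, 0])
      {v | 0 < v 1} v := fun v _ => (hasFDerivAt_quadOfComplex v).hasFDerivWithinAt
  have hmp := Complex.volume_preserving_equiv_pi.symm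
  have hme := Complex.measurableEquivPi.symm.measurableEmbedding
  have hpre : {v : Fin 2 → ℝ | 0 < v 1} = Complex.measurableEquivPi.symm ⁻¹' {z | 0 < z.im} := by
    ext v; simp [Complex.measurableEquivPi]
  have hval : ∀ v ∈ {v : Fin 2 → ℝ | 0 < v 1},
      |(planeDeriv !![2 * v 0, 2 * v 1; -2, 0]).det| •
        (polyWeight Φ s (toMonic (quadOfComplex ⟨v 0, v 1⟩)) *
        pairKernel P Q (quadOfComplex ⟨v 0, v 1⟩)) =
      (fun z : ℂ => -2 * Complex.I * (H z - H (Complex.conjLIE.toMeasurableEquiv z)))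
        (Complex.measurableEquivPi.symm v) := by
    intro v hv
    rw [Set.mem_ofPred_eq] at hv
    have e1 : (planeDeriv !![2 * v 0, 2 * v 1; -2, 0]).det = 4 * v 1 := by
      rw [det_planeDeriv]; simp; ring
    have e2 : Complex.measurableEquivPi.symm v = ⟨v 0, v 1⟩ := by
      apply Complex.ext <;> simp [Complex.measurableEquivPi]
    rw [e1, abs_of_pos (by linarith), polyWeight_toMonic_two hΦ, pairKernel, e2]
    set β : ℂ := ⟨v 0, v 1⟩ with hβ
    have hβi : β.im = v 1 := rfl
    have e3 : Complex.conjLIE.toMeasurableEquiv β = starRingEnd ℂ β := rfl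
    have e4 : β - starRingEnd ℂ β = 2 * Complex.I * (v 1 : ℂ) := by
      rw [Complex.sub_conj, hβi]; push_cast; ring
    have hne : (v 1 : ℂ) ≠ 0 := Complex.ofReal_ne_zero.2 hv.ne'
    rw [rootFst_quadOfComplex (β := β) hv.le, rootSnd_quadOfComplex (β := β) hv.le, e4]
    simp only [e3, hH, Complex.real_smul, Complex.conj_conj]
    push_cast
    field_simp
    linear_combination (4 * rootWeight Φ s (starRingEnd ℂ β) * rootWeight Φ s β *
      (P.eval (starRingEnd ℂ β) * Q.eval β - P.eval β * Q.eval (starRingEnd ℂ β))) * Complex.I_sq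
  rw [← image_quadOfComplex]
  constructor
  · rw [integrableOn_image_iff_integrableOn_abs_det_fderiv_smul volume hs hd injOn_quadOfComplex,
      integrableOn_congr_fun hval hs, hpre]
    exact (hmp.integrableOn_comp_preimage hme).2 h1'
  · rw [integral_image_eq_integral_abs_det_fderiv_smul volume hs hd injOn_quadOfComplex,
      setIntegral_congr_fun hs hval, hpre, hmp.setIntegral_preimage_emb hme
        (fun z : ℂ => -2 * Complex.I * (H z - H (Complex.conjLIE.toMeasurableEquiv z)))]

theorem integral_polyWeight_mul_pairKernel (hΦ : IsMultiplicativeDistanceFunction Φ) {s : ℂ}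
    {P Q : ℂ[X]} (hP : (P.natDegree : ℝ) + 1 < s.re) (hQ : (Q.natDegree : ℝ) + 1 < s.re) :
    Integrable (fun q => polyWeight Φ s (toMonic q) * pairKernel P Q q) ∧
      ∫ q, polyWeight Φ s (toMonic q) * pairKernel P Q q = skewForm Φ s P Q := by
  obtain ⟨h1, h2⟩ := setIntegral_quadDisc_pos hΦ hP hQ
  obtain ⟨h3, h4⟩ := setIntegral_quadDisc_neg hΦ hP hQ
  have hae : ({q | 0 < quadDisc q} ∪ {q | quadDisc q < 0} : Set (Fin 2 → ℝ)) =ᵐ[volume]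
      Set.univ := by
    rw [ae_eq_univ]
    refine measure_mono_null (fun q hq => ?_) volume_quadDisc_eq_zero
    simp only [Set.mem_compl_iff, Set.mem_union, Set.mem_ofPred_eq, not_or, not_lt] at hq
    exact le_antisymm hq.1 hq.2
  have hdisj : Disjoint {q | 0 < quadDisc q} {q : Fin 2 → ℝ | quadDisc q < 0} :=
    Set.disjoint_left.2 fun q (h : 0 < quadDisc q) (h' : quadDisc q < 0) => lt_asymm h h'
  refine ⟨?_, ?_⟩
  · rw [← integrableOn_univ, ← integrableOn_congr_set_ae hae]
    exact h1.union h3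
  · rw [← setIntegral_univ, ← setIntegral_congr_set hae,
      setIntegral_union hdisj (continuous_quadDisc.measurable measurableSet_Iio) h1 h3, h2, h4]
    rfl

end SkewFormIntegral

/-! ### Conclusion of the proof. -/

theorem monicPoly_eq_map_toMonic (N : ℕ) (b : Fin N → ℝ) :
    monicPoly N b = (toMonic fun i => b (Fin.rev i)).map (algebraMap ℝ ℂ) := by
  rw [map_toMonic, monicPoly, ← Equiv.sum_comp Fin.revPerm]
  congr 1
  refine Finset.sum_congr rfl fun i _ => ?_
  have : N - ((Fin.rev i : ℕ) + 1) = i := by rw [Fin.val_rev]; omega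
  rw [Fin.revPerm_apply, this]

theorem measurePreserving_rev (N : ℕ) :
    MeasurePreserving (MeasurableEquiv.piCongrLeft (fun _ : Fin N => ℝ) Fin.revPerm) :=
  volume_measurePreserving_piCongrLeft (fun _ : Fin N => ℝ) Fin.revPerm

theorem momentIntegrand_eq (Φ : ℂ[X] → ℝ) (N : ℕ) (s : ℂ) (b : Fin N → ℝ) :
    momentIntegrand Φ N s b = polyWeight Φ s
      (toMonic (MeasurableEquiv.piCongrLeft (fun _ : Fin N => ℝ) Fin.revPerm b)) := by
  have : MeasurableEquiv.piCongrLeft (fun _ : Fin N => ℝ) Fin.revPerm b =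
      fun i => b (Fin.rev i) := by
    funext i
    obtain ⟨j, rfl⟩ := Fin.revPerm.surjective i
    rw [MeasurableEquiv.coe_piCongrLeft, Equiv.piCongrLeft_apply_apply]
    simp
  rw [momentIntegrand, polyWeight, monicPoly_eq_map_toMonic, this]

theorem ae_quadDisc_ne_zero (J : ℕ) :
    ∀ᵐ q : Fin J → Fin 2 → ℝ, ∀ k, quadDisc (q k) ≠ 0 := by
  rw [ae_all_iff]
  intro k
  have h : ∀ᵐ q : Fin 2 → ℝ, quadDisc q ≠ 0 := by
    rw [ae_iff]
    simpa using volume_quadDisc_eq_zero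
  exact (Measure.quasiMeasurePreserving_eval (fun _ : Fin J => (volume : Measure (Fin 2 → ℝ)))
    k).ae h

theorem corollary2 (Φ : ℂ[X] → ℝ) (hΦ : IsMultiplicativeDistanceFunction Φ)
    (J : ℕ) (s : ℂ) (hs : ((2 * J : ℕ) : ℝ) < s.re)
    (Q : Fin (2 * J) → ℂ[X]) (hQ : IsCompleteMonicFamily Q)
    (M : Fin J → ℂ) (hQM : IsSkewOrthogonal Φ s Q M) :
    Integrable (momentIntegrand Φ (2 * J) s) volume ∧
      realMoment Φ (2 * J) s = ∏ j : Fin J, M j := by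
  have hmp := measurePreserving_rev (2 * J)
  have hme := (MeasurableEquiv.piCongrLeft (fun _ : Fin (2 * J) => ℝ)
    Fin.revPerm).measurableEmbedding
  have hint := integrable_polyWeight_toMonic hΦ hs
  have hfun : momentIntegrand Φ (2 * J) s = fun b => polyWeight Φ s
      (toMonic (MeasurableEquiv.piCongrLeft (fun _ : Fin (2 * J) => ℝ) Fin.revPerm b)) :=
    funext fun b => momentIntegrand_eq Φ (2 * J) s b
  refine ⟨by rw [hfun]; exact (hmp.integrable_comp_emb hme).2 hint, ?_⟩
  rw [realMoment, hfun, hmp.integral_comp hme fun c => polyWeight Φ s (toMonic c)]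
  obtain ⟨_, -, h⟩ := integral_quadPullback J
  obtain ⟨-, hpull, -⟩ := h _ (continuous_polyWeight_toMonic hΦ s (2 * J)) hint
  -- The degrees are at most `2J - 1`, so `Re s > 2J` is enough for all the pairings to converge.
  have hdeg : ∀ i : Fin (2 * J), ((Q i).natDegree : ℝ) + 1 < s.re := by
    intro i
    refine lt_of_le_of_lt ?_ hs
    rw [(hQ i).2]
    exact_mod_cast i.2
  have hker := fun i j => integral_polyWeight_mul_pairKernel hΦ (hdeg i) (hdeg j)
  set B : Fin J × Fin 2 → Fin J × Fin 2 → ℂ := fun a b =>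
    skewForm Φ s (Q (pairIndex J a)) (Q (pairIndex J b)) with hB
  have hexp : (fun q : Fin J → Fin 2 → ℝ => 2 ^ J * quadPullback (polyWeight Φ s) q) =ᵐ[volume]
      fun q => ∑ σ : Equiv.Perm (Fin J × Fin 2), ((Equiv.Perm.sign σ : ℤ) : ℂ) *
        ∏ k, (polyWeight Φ s (toMonic (q k)) *
          pairKernel (Q (pairIndex J (σ (k, 0)))) (Q (pairIndex J (σ (k, 1)))) (q k)) := by
    filter_upwards [ae_quadDisc_ne_zero J] with q hq
    rw [quadPullback, ← mul_assoc, two_pow_mul_resultantProd hQ hq, polyWeight_prod hΦ,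
      Finset.sum_mul]
    refine Finset.sum_congr rfl fun σ _ => ?_
    rw [Finset.prod_mul_distrib]
    ring
  have h1 : ∫ q : Fin J → Fin 2 → ℝ, 2 ^ J * quadPullback (polyWeight Φ s) q =
      ∑ σ : Equiv.Perm (Fin J × Fin 2), ((Equiv.Perm.sign σ : ℤ) : ℂ) *
        ∏ k, B (σ (k, 0)) (σ (k, 1)) := by
    -- The weight is multiplicative, so every summand is a product of functions of separate
    -- quadratics and integrates to a product of skew forms.
    rw [integral_congr_ae hexp, integral_finsetSum]
    · refine Finset.sum_congr rfl fun σ _ => ?_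
      rw [integral_const_mul, integral_fintype_prod_volume_eq_prod fun k q =>
        polyWeight Φ s (toMonic q) *
          pairKernel (Q (pairIndex J (σ (k, 0)))) (Q (pairIndex J (σ (k, 1)))) q]
      congr 1
      exact Finset.prod_congr rfl fun k _ => (hker _ _).2
    · intro σ _
      exact (Integrable.fintype_prod fun k => (hker (pairIndex J (σ (k, 0)))
        (pairIndex J (σ (k, 1)))).1).const_mul _
  rw [sum_perm_prod_skew_block B M, integral_const_mul, hpull] at h1
  · have h2 : (2 : ℂ) ^ J ≠ 0 := pow_ne_zero _ two_ne_zero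
    have h3 : (J.factorial : ℂ) ≠ 0 := Nat.cast_ne_zero.2 J.factorial_ne_zero
    rw [mul_assoc] at h1
    exact mul_left_cancel₀ h3 (mul_left_cancel₀ h2 h1)
  · intro i j
    simp only [hB, pairIndex_fst, pairIndex_snd, hQM.fst_snd i j]
  · intro i j
    simp only [hB, pairIndex_fst, pairIndex_snd, ← hQM.snd_fst i j, neg_neg]
  · intro i j
    simp only [hB, pairIndex_fst, hQM.fst_fst i j]
  · intro i j
    simp only [hB, pairIndex_snd, hQM.snd_snd i j]
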